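/- Let $n\ge 1$ and let $\mathcal S_1,\dots,\mathcal S_n$ be disjoint finite sets. Let $\{\varphi(t)\}_{t\ge 0}$ be a time-homogeneous (right-continuous) Markov jump process on the finite state space $\{\star\}\cup\mathcal S_1\cup\cdots\cup\mathcal S_n$, where $\star$ is absorbing and every state of $\mathcal S_1\cup\cdots\cup\mathcal S_n$ is transient. Assume that its generator $\Lambda$ is block bidiagonal: for each $k$ the block of $\Lambda$ on $\mathcal S_k\times\mathcal S_k$ is a square matrix $A_k$; for $k<n$ the block on $\mathcal S_k\times\mathcal S_{k+1}$ is a matrix $D_k$; the column of rates from $\mathcal S_n$ to $\star$ is $D_n\mathbf 1$, where $D_n$ is a real matrix with rows indexed by $\mathcal S_n$ and any finite number of columns; and all other entries of $\Lambda$ are zero. Assume that the process starts in $\mathcal S_1$ according to the probability (row) vector $\boldsymbol\alpha$, i.e. $\mathbb P(\varphi(0)=i)=\alpha_i$ for $i\in\mathcal S_1$ and $\sum_{i\in\mathcal S_1}\alpha_i=1$. Let $$Y_k=\int_0^\infty \mathbf 1_{\{\varphi(s)\in\mathcal S_k\}}\,ds,\qquad k=1,\dots,n,$$ be the time that the process spends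 in $\mathcal S_k$. Then $Y_1,\dots,Y_n$ are almost surely finite, and the random vector $(Y_1,\dots,Y_n)$ has a joint density with respect to Lebesgue measure on $\mathbb R^n$, given by $$f(y_1,\dots,y_n)=\boldsymbol\alpha\, e^{A_1y_1}D_1\,e^{A_2y_2}D_2\cdots e^{A_ny_n}D_n\,\mathbf 1\ \ (\ge 0)$$ for $y_1,\dots,y_n\ge 0$, and by $0$ elsewhere. Here $\mathbf 1$ is a column vector of ones. -/

import Mathlib

open MeasureTheory
open scoped NNReal ENNReal Matrix

namespace MultPH

/-! ### Finite-state Markov jump processes -/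

section MarkovJump

variable {E : Type*} [Fintype E] [DecidableEq E]

/-- `Λ` is the generator of a (conservative) Markov jump process on the finite set `E`:
nonnegative rates off the diagonal, and rows that sum to zero. -/
structure IsGenerator (Λ : Matrix E E ℝ) : Prop where
  rate_nonneg : ∀ i j, i ≠ j → 0 ≤ Λ i j
  row_sum : ∀ i, ∑ j, Λ i j = 0

/-- The transition matrix `e^{tΛ}` over a time span `t`. -/
noncomputable def transition (Λ : Matrix E E ℝ) (t : ℝ) : Matrix E E ℝ :=
  NormedSpace.exp (t • Λ)

/-- The state `i` is transient: the expected total time spent in `i` by the process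
started in `i`, that is `∫₀^∞ (e^{tΛ})ᵢᵢ dt`, is finite. -/
def IsTransient (Λ : Matrix E E ℝ) (i : E) : Prop :=
  IntegrableOn (fun t : ℝ => transition Λ t i i) (Set.Ici 0)

/-- `X` is a time-homogeneous Markov jump process on the finite set `E` with generator `Λ` and
initial distribution `π`, on the probability space `(Ω, P)`. -/
structure IsMarkovJumpProcess {Ω : Type*} [MeasurableSpace Ω] (P : Measure Ω)
    (Λ : Matrix E E ℝ) (π : E → ℝ) (X : ℝ≥0 → Ω → E) : Prop where
  measurable : ∀ t i, MeasurableSet {ω | X t ω = i}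
  /-- almost every path is right-continuous for the discrete topology of `E` -/
  right_continuous : ∀ᵐ ω ∂P, ∀ t : ℝ≥0, ∃ ε : ℝ≥0, 0 < ε ∧
    ∀ s, t ≤ s → s < t + ε → X s ω = X t ω
  initial : ∀ i, P.real {ω | X 0 ω = i} = π i
  /-- the Markov property `P(X_{t_m + h} = j | X_{t_0} = x_0, …, X_{t_m} = x_m) = (e^{hΛ})_{x_m j}`
  for `t_0 ≤ ⋯ ≤ t_m`, with the conditioning event multiplied out -/
  markov : ∀ (m : ℕ) (t : Fin (m + 1) → ℝ≥0), Monotone t →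
    ∀ (x : Fin (m + 1) → E) (h : ℝ≥0) (j : E),
      P.real {ω | (∀ r, X (t r) ω = x r) ∧ X (t (Fin.last m) + h) ω = j} =
        P.real {ω | ∀ r, X (t r) ω = x r} * transition Λ h (x (Fin.last m)) j

end MarkovJump

/-! ### The sequential class

The blocks are `S 0, …, S (n-1)`. The extra index set `S n` only labels the columns of the last
matrix `D (n-1)`, which enters the model through its row sums alone. -/

section Sequential

variable {n : ℕ} {S : Fin (n + 1) → Type*}

/-- The state space `{⋆} ∪ S 0 ∪ ⋯ ∪ S (n-1)` (disjoint union), with `⋆ = none`. -/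
abbrev State (S : Fin (n + 1) → Type*) : Type _ :=
  Option (Σ k : Fin n, S k.castSucc)

/-- The set of states that lie in the `k`-th block. -/
def block (S : Fin (n + 1) → Type*) (k : Fin n) : Set (State S) :=
  {x | ∃ i : S k.castSucc, x = some ⟨k, i⟩}

/-- The block bidiagonal generator: `A k` on the diagonal, `D k` from block `k` to block `k + 1`,
the row sums of the last `D` as rates from the last block to `⋆`, and a zero row at `⋆`. -/
def gen [∀ k, Fintype (S k)]
    (A : ∀ k : Fin n, Matrix (S k.castSucc) (S k.castSucc) ℝ)
    (D : ∀ k : Fin n, Matrix (S k.castSucc) (S k.succ) ℝ) :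
    Matrix (State S) (State S) ℝ
  | none, _ => 0
  | some ⟨k, i⟩, none => if k.succ = Fin.last n then ∑ j, D k i j else 0
  | some ⟨k, i⟩, some ⟨l, j⟩ =>
    if h : l.castSucc = k.castSucc then A k i (cast (congrArg S h) j)
    else if h : l.castSucc = k.succ then D k i (cast (congrArg S h) j)
    else 0

/-- The initial vector `[0 | α 0 ⋯ 0]`. -/
def init (α : S 0 → ℝ) : State S → ℝ
  | none => 0
  | some ⟨k, i⟩ => if h : k.castSucc = 0 then α (cast (congrArg S h) i) else 0

/-- The time `∫₀^∞ 1{X_s ∈ S k} ds ∈ [0, ∞]` spent by `X` in the `k`-th block. -/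
noncomputable def occupation {Ω : Type*} (X : ℝ≥0 → Ω → State S) (k : Fin n) (ω : Ω) : ℝ≥0∞ :=
  ∫⁻ s in Set.Ici (0 : ℝ), (block S k).indicator (fun _ => (1 : ℝ≥0∞)) (X s.toNNReal ω)

/-- The row vector `α e^{A 0 y 0} D 0 ⋯ e^{A (k-1) y (k-1)} D (k-1)`, indexed by `S k`. -/
noncomputable def rowProd [∀ k, Fintype (S k)] [∀ k, DecidableEq (S k)]
    (α : S 0 → ℝ)
    (A : ∀ k : Fin n, Matrix (S k.castSucc) (S k.castSucc) ℝ)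
    (D : ∀ k : Fin n, Matrix (S k.castSucc) (S k.succ) ℝ)
    (y : Fin n → ℝ) (k : Fin (n + 1)) : S k → ℝ :=
  Fin.induction (motive := fun k => S k → ℝ) α
    (fun k v => (v ᵥ* NormedSpace.exp (y k • A k)) ᵥ* D k) k

/-- `f(y) = α e^{A 0 y 0} D 0 ⋯ e^{A (n-1) y (n-1)} D (n-1) 1`. -/
noncomputable def jointDensity [∀ k, Fintype (S k)] [∀ k, DecidableEq (S k)]
    (α : S 0 → ℝ)
    (A : ∀ k : Fin n, Matrix (S k.castSucc) (S k.castSucc) ℝ)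
    (D : ∀ k : Fin n, Matrix (S k.castSucc) (S k.succ) ℝ)
    (y : Fin n → ℝ) : ℝ :=
  rowProd α A D y (Fin.last n) ⬝ᵥ 1

end Sequential

end MultPH

/-!
Write `ℓ x` for the index of the block that contains `x`, with `ℓ ⋆ = n`. Almost every path climbs
through the blocks one at a time, so it has left the blocks `0, …, k` for good at time
`T k = Y 0 + ⋯ + Y k`, and `t < T k` if and only if `ℓ (X t) ≤ k`. For `t 0 ≤ t 1 ≤ ⋯` the Markov
property therefore gives
`P (t 0 < T 0, …, t m < T m) = π e^{t₀Λ} Π₀ e^{(t₁-t₀)Λ} Π₁ ⋯ e^{(tₘ-tₘ₋₁)Λ} Πₘ 1`,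
where `Π k` is the projection onto the blocks `0, …, k`.

The density has the same survival function. The commutator `Π k * Λ - Λ * Π k` is the matrix `D k`
of the rates from block `k` to block `k + 1`, so that `p e^{cΛ} Π k e^{(t-c)Λ} w` is a function of
`c` with derivative `-p e^{cΛ} D k e^{(t-c)Λ} w`. Integrating out the coordinates of the density one
after the other, each integral is hence given by the fundamental theorem of calculus, and the
boundary term at infinity vanishes because the states of the blocks are transient.

Both laws are carried by the vectors whose partial sums are positive and increasing, and such a law
is determined by its survival function on increasing `t`: if `T` is increasing, then `t k < T k` for
all `k` if and only if `max (t 0) … (t k) < T k` for all `k`.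
-/

namespace MultPH

open Filter Topology

section Transition

variable {E : Type*} [Fintype E] [DecidableEq E]

@[simp] theorem transition_zero (Λ : Matrix E E ℝ) : transition Λ 0 = 1 := by
  simp [transition]

theorem transition_add (Λ : Matrix E E ℝ) (s t : ℝ) :
    transition Λ (s + t) = transition Λ s * transition Λ t := by
  rw [transition, add_smul]
  exact Matrix.exp_add_of_commute _ _ (((Commute.refl Λ).smul_left s).smul_right t)

open scoped Matrix.Norms.Operator in
theorem hasDerivAt_transition (Λ : Matrix E E ℝ) (t : ℝ) :
    HasDerivAt (transition Λ) (transition Λ t * Λ) t :=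
  hasDerivAt_exp_smul_const (𝕂 := ℝ) Λ t

open scoped Matrix.Norms.Operator in
theorem transition_mul_comm (Λ : Matrix E E ℝ) (t : ℝ) :
    transition Λ t * Λ = Λ * transition Λ t :=
  (hasDerivAt_transition Λ t).unique (hasDerivAt_exp_smul_const' (𝕂 := ℝ) Λ t)

@[fun_prop]
theorem continuous_transition (Λ : Matrix E E ℝ) : Continuous (transition Λ) := by
  open scoped Matrix.Norms.Operator in
  exact continuous_iff_continuousAt.2 fun t => (hasDerivAt_transition Λ t).continuousAt

theorem hasDerivAt_transition_apply (Λ : Matrix E E ℝ) (i j : E) (t : ℝ) :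
    HasDerivAt (fun t => transition Λ t i j) ((transition Λ t * Λ) i j) t := by
  open scoped Matrix.Norms.Operator in
  exact hasDerivAt_pi.1 (hasDerivAt_pi.1 (hasDerivAt_transition Λ t) i) j

theorem hasDerivAt_vecMul_transition (Λ : Matrix E E ℝ) (v : E → ℝ) (t : ℝ) :
    HasDerivAt (fun t => v ᵥ* transition Λ t) ((v ᵥ* transition Λ t) ᵥ* Λ) t := by
  refine hasDerivAt_pi.2 fun j => ?_
  rw [Matrix.vecMul_vecMul]
  exact HasDerivAt.fun_sum fun i _ => (hasDerivAt_transition_apply Λ i j t).const_mul (v i)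

theorem hasDerivAt_transition_mulVec (Λ : Matrix E E ℝ) (w : E → ℝ) (t : ℝ) :
    HasDerivAt (fun t => transition Λ t *ᵥ w) (Λ *ᵥ (transition Λ t *ᵥ w)) t := by
  refine hasDerivAt_pi.2 fun i => ?_
  rw [Matrix.mulVec_mulVec, ← transition_mul_comm]
  exact HasDerivAt.fun_sum fun j _ => (hasDerivAt_transition_apply Λ i j t).mul_const (w j)

theorem hasDerivAt_transition_sub_mulVec (Λ : Matrix E E ℝ) (w : E → ℝ) (c t : ℝ) :
    HasDerivAt (fun t => transition Λ (c - t) *ᵥ w) (-(Λ *ᵥ (transition Λ (c - t) *ᵥ w))) t :=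
  (hasDerivAt_transition_mulVec Λ w (c - t)).comp_const_sub c t

omit [DecidableEq E] in
theorem hasDerivAt_dotProduct {p q : ℝ → E → ℝ} {p' q' : E → ℝ} {t : ℝ}
    (hp : HasDerivAt p p' t) (hq : HasDerivAt q q' t) :
    HasDerivAt (fun t => p t ⬝ᵥ q t) (p' ⬝ᵥ q t + p t ⬝ᵥ q') t := by
  simp only [dotProduct, ← Finset.sum_add_distrib]
  exact HasDerivAt.fun_sum fun i _ => (hasDerivAt_pi.1 hp i).mul (hasDerivAt_pi.1 hq i)

theorem eq_vecMul_transition_of_hasDerivAt {Λ : Matrix E E ℝ} {z : ℝ → E → ℝ}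
    (hz : ∀ t, HasDerivAt z (z t ᵥ* Λ) t) (t : ℝ) : z t = z 0 ᵥ* transition Λ t := by
  refine dotProduct_eq _ _ fun w => ?_
  have hderiv (s : ℝ) : HasDerivAt (fun s => z s ⬝ᵥ (transition Λ (t - s) *ᵥ w)) 0 s :=
    (hasDerivAt_dotProduct (hz s) (hasDerivAt_transition_sub_mulVec Λ w t s)).congr_deriv (by
      rw [dotProduct_neg, Matrix.dotProduct_mulVec _ Λ, add_neg_cancel])
  have hconst := is_const_of_deriv_eq_zero (fun s => (hderiv s).differentiableAt)
    (fun s => (hderiv s).deriv) t 0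
  simpa [Matrix.dotProduct_mulVec] using hconst

theorem one_apply_le_exp_apply {M : Matrix E E ℝ} (hM : ∀ i j, 0 ≤ M i j) (i j : E) :
    (1 : Matrix E E ℝ) i j ≤ NormedSpace.exp M i j := by
  have hpow (p : ℕ) : ∀ i j, 0 ≤ (M ^ p) i j := by
    induction p with
    | zero => intro i j; by_cases h : i = j <;> simp [h]
    | succ p ih =>
      intro i j
      rw [pow_succ, Matrix.mul_apply]
      exact Finset.sum_nonneg fun k _ => mul_nonneg (ih i k) (hM k j)
  have hsum : HasSum (fun p : ℕ => ((p.factorial : ℝ)⁻¹) * (M ^ p) i j)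
      (NormedSpace.exp M i j) := by
    open scoped Matrix.Norms.Operator in
    exact (NormedSpace.exp_series_hasSum_exp' (𝕂 := ℝ) M).map (Matrix.entryAddMonoidHom ℝ i j)
      (continuous_apply_apply i j)
  simpa using le_hasSum hsum 0 fun p _ => mul_nonneg (by positivity) (hpow p i j)

theorem exp_add_smul_one (M : Matrix E E ℝ) (c : ℝ) :
    NormedSpace.exp (M + c • (1 : Matrix E E ℝ)) = Real.exp c • NormedSpace.exp M := by
  have hdiag : NormedSpace.exp (c • (1 : Matrix E E ℝ)) = Real.exp c • 1 := by
    rw [Matrix.smul_one_eq_diagonal, Matrix.exp_diagonal, Matrix.smul_one_eq_diagonal]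
    congr 1
    ext i
    rw [Pi.coe_exp, Real.exp_eq_exp_ℝ]
  rw [Matrix.exp_add_of_commute _ _ ((Commute.one_right M).smul_right c), hdiag, mul_smul_comm,
    mul_one]

namespace IsGenerator

variable {Λ : Matrix E E ℝ}

omit [DecidableEq E] in
theorem mulVec_one (hΛ : IsGenerator Λ) : Λ *ᵥ 1 = 0 :=
  funext fun i => by simpa [Matrix.mulVec, dotProduct] using hΛ.row_sum i

/-- Uniformization: `t (Λ + c)` has nonnegative entries as soon as `-c` is below the diagonal
of `Λ`. -/
theorem exists_exp_neg_mul_one_apply_le_transition (hΛ : IsGenerator Λ) {t : ℝ} (ht : 0 ≤ t) :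
    ∃ c : ℝ, ∀ i j, Real.exp (-c) * (1 : Matrix E E ℝ) i j ≤ transition Λ t i j := by
  set c : ℝ := ∑ i, |Λ i i|
  have hM (i j : E) : 0 ≤ (t • Λ + (t * c) • (1 : Matrix E E ℝ)) i j := by
    rw [mul_smul, ← smul_add, Matrix.smul_apply, Matrix.add_apply, Matrix.smul_apply]
    refine mul_nonneg ht ?_
    rcases eq_or_ne i j with rfl | hij
    · have : |Λ i i| ≤ c :=
        Finset.single_le_sum (f := fun i => |Λ i i|) (fun i _ => abs_nonneg _) (Finset.mem_univ i)
      rw [Matrix.one_apply_eq, smul_eq_mul, mul_one]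
      linarith [neg_abs_le (Λ i i)]
    · simpa [Matrix.one_apply_ne hij] using hΛ.rate_nonneg i j hij
  refine ⟨t * c, fun i j => ?_⟩
  rw [Real.exp_neg, inv_mul_le_iff₀ (Real.exp_pos _)]
  simpa only [transition, exp_add_smul_one, Matrix.smul_apply, smul_eq_mul] using
    one_apply_le_exp_apply hM i j

theorem transition_nonneg (hΛ : IsGenerator Λ) {t : ℝ} (ht : 0 ≤ t) (i j : E) :
    0 ≤ transition Λ t i j := by
  obtain ⟨c, hc⟩ := hΛ.exists_exp_neg_mul_one_apply_le_transition ht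
  exact (mul_nonneg (Real.exp_pos _).le
    (by by_cases h : i = j <;> simp [Matrix.one_apply, h])).trans (hc i j)

theorem transition_self_pos (hΛ : IsGenerator Λ) {t : ℝ} (ht : 0 ≤ t) (i : E) :
    0 < transition Λ t i i := by
  obtain ⟨c, hc⟩ := hΛ.exists_exp_neg_mul_one_apply_le_transition ht
  exact (by simpa using Real.exp_pos _ : 0 < Real.exp (-c) * (1 : Matrix E E ℝ) i i).trans_le
    (hc i i)

theorem vecMul_transition_nonneg (hΛ : IsGenerator Λ) {v : E → ℝ} (hv : 0 ≤ v) {t : ℝ}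
    (ht : 0 ≤ t) : 0 ≤ v ᵥ* transition Λ t :=
  fun j => dotProduct_nonneg_of_nonneg hv fun i => hΛ.transition_nonneg ht i j

theorem transition_mulVec_nonneg (hΛ : IsGenerator Λ) {w : E → ℝ} (hw : 0 ≤ w) {t : ℝ}
    (ht : 0 ≤ t) : 0 ≤ transition Λ t *ᵥ w :=
  fun i => dotProduct_nonneg_of_nonneg (hΛ.transition_nonneg ht i) hw

end IsGenerator

end Transition

section Green

variable {E : Type*} [Fintype E] [DecidableEq E] {Λ : Matrix E E ℝ}

omit [DecidableEq E] in
theorem IsGenerator.mulVec_apply_nonpos_of_forall_le (hΛ : IsGenerator Λ) {f : E → ℝ} {j : E}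
    (hf : ∀ k, f k ≤ f j) : (Λ *ᵥ f) j ≤ 0 := by
  have hshift : (Λ *ᵥ f) j = ∑ k, Λ j k * (f k - f j) := by
    simp only [mul_sub, Finset.sum_sub_distrib, ← Finset.sum_mul, hΛ.row_sum, zero_mul, sub_zero]
    rfl
  rw [hshift]
  refine Finset.sum_nonpos fun k _ => ?_
  rcases eq_or_ne j k with rfl | hjk
  · simp
  · exact mul_nonpos_of_nonneg_of_nonpos (hΛ.rate_nonneg j k hjk) (sub_nonpos.2 (hf k))

theorem mulVec_integral_transition (Λ : Matrix E E ℝ) (i : E) (T : ℝ) :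
    Λ *ᵥ (fun j => ∫ t in (0)..T, transition Λ t j i) =
      fun j => transition Λ T j i - (1 : Matrix E E ℝ) j i := by
  ext j
  have hcont (k l : E) : Continuous fun t => transition Λ t k l :=
    (continuous_transition Λ).matrix_elem k l
  have hderiv (t : ℝ) :
      HasDerivAt (fun t => transition Λ t j i) (∑ k, Λ j k * transition Λ t k i) t :=
    (hasDerivAt_transition_apply Λ j i t).congr_deriv (by rw [transition_mul_comm]; rfl)
  rw [← transition_zero Λ, ← intervalIntegral.integral_eq_sub_of_hasDerivAt
    (fun t _ => hderiv t) (Continuous.intervalIntegrable (by fun_prop) _ _),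
    intervalIntegral.integral_finsetSum
      fun k _ => ((hcont k i).const_mul _).intervalIntegrable _ _]
  simp only [intervalIntegral.integral_const_mul]
  rfl

/-- Maximum principle for `f j = ∫₀ᵀ (e^{tΛ})ⱼᵢ dt`, which solves `(Λ f) j = (e^{TΛ})ⱼᵢ - δⱼᵢ`. -/
theorem IsGenerator.integral_transition_le (hΛ : IsGenerator Λ) {T : ℝ} (hT : 0 ≤ T) (i j : E) :
    ∫ t in (0)..T, transition Λ t j i ≤ ∫ t in (0)..T, transition Λ t i i := by
  set f : E → ℝ := fun j => ∫ t in (0)..T, transition Λ t j i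
  have : Nonempty E := ⟨i⟩
  obtain ⟨m, hm⟩ := Finite.exists_max f
  rcases eq_or_ne m i with rfl | hmi
  · exact hm j
  refine (hm j).trans ?_
  have hTmi : transition Λ T m i = 0 := by
    refine le_antisymm ?_ (hΛ.transition_nonneg hT m i)
    simpa [f, mulVec_integral_transition, Matrix.one_apply_ne hmi] using
      hΛ.mulVec_apply_nonpos_of_forall_le hm
  refine intervalIntegral.integral_mono_on hT
    (((continuous_transition Λ).matrix_elem m i).intervalIntegrable _ _)
    (((continuous_transition Λ).matrix_elem i i).intervalIntegrable _ _) fun t ht => ?_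
  have hprod : transition Λ t m i * transition Λ (T - t) i i ≤ transition Λ T m i := by
    rw [← add_sub_cancel t T, transition_add, Matrix.mul_apply, add_sub_cancel]
    exact Finset.single_le_sum (f := fun k => transition Λ t m k * transition Λ (T - t) k i)
      (fun k _ => mul_nonneg (hΛ.transition_nonneg ht.1 m k)
        (hΛ.transition_nonneg (sub_nonneg.2 ht.2) k i)) (Finset.mem_univ i)
  have hpos := hΛ.transition_self_pos (sub_nonneg.2 ht.2) i
  exact (nonpos_of_mul_nonpos_left (hprod.trans hTmi.le) hpos).trans
    (hΛ.transition_nonneg ht.1 i i)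

theorem IsTransient.integrableOn_transition (hΛ : IsGenerator Λ) {i : E} (hi : IsTransient Λ i)
    (j : E) : IntegrableOn (fun t => transition Λ t j i) (Set.Ioi 0) := by
  have hcont (k : E) : Continuous fun t => transition Λ t k i :=
    (continuous_transition Λ).matrix_elem k i
  refine integrableOn_Ioi_of_intervalIntegral_norm_bounded (∫ t in Set.Ioi 0, transition Λ t i i) 0
    (fun T => (hcont j).integrableOn_Ioc) tendsto_id ?_
  filter_upwards [eventually_ge_atTop 0] with T hT
  calc ∫ t in (0)..T, ‖transition Λ t j i‖
      = ∫ t in (0)..T, transition Λ t j i :=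
        intervalIntegral.integral_congr fun t ht =>
          Real.norm_of_nonneg (hΛ.transition_nonneg (Set.uIcc_of_le hT ▸ ht).1 j i)
    _ ≤ ∫ t in (0)..T, transition Λ t i i := hΛ.integral_transition_le hT i j
    _ ≤ ∫ t in Set.Ioi 0, transition Λ t i i := by
        rw [intervalIntegral.integral_of_le hT]
        exact setIntegral_mono_set (hi.mono_set Set.Ioi_subset_Ici_self)
          (ae_restrict_of_forall_mem measurableSet_Ioi fun t ht => hΛ.transition_nonneg ht.le i i)
          Set.Ioc_subset_Ioi_self.eventuallyLE

end Green

section Sequential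

variable {E : Type*} [Fintype E] [DecidableEq E] {Λ : Matrix E E ℝ} {ℓ : E → ℕ}

theorem transition_apply_eq_zero (hΛ : Λ.BlockTriangular ℓ) (t : ℝ) {i j : E} (hij : ℓ j < ℓ i) :
    transition Λ t i j = 0 := by
  have htΛ : (t • Λ).BlockTriangular ℓ := fun i j hij => by simp [hΛ hij]
  exact htΛ.exp hij

/-- `Λ` is the generator of a process whose level `ℓ` only ever jumps to the next level. The blocks
of a block bidiagonal generator are the levels of such a process. -/
structure IsSequentialGenerator (Λ : Matrix E E ℝ) (ℓ : E → ℕ) : Prop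
    extends IsGenerator Λ where
  rate_eq_zero : ∀ i j, ℓ j ≠ ℓ i → ℓ j ≠ ℓ i + 1 → Λ i j = 0

namespace IsSequentialGenerator

omit [DecidableEq E] in
theorem blockTriangular (h : IsSequentialGenerator Λ ℓ) : Λ.BlockTriangular ℓ :=
  fun i j hij => h.rate_eq_zero i j hij.ne (by omega)

theorem tendsto_transition_apply (h : IsSequentialGenerator Λ ℓ) {m : ℕ}
    (htr : ∀ i, ℓ i ≤ m → IsTransient Λ i) (i : E) {j : E} (hj : ℓ j ≤ m) :
    Tendsto (fun t => transition Λ t i j) atTop (𝓝 0) := by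
  refine tendsto_zero_of_hasDerivAt_of_integrableOn_Ioi (a := 0)
    (fun t _ => hasDerivAt_transition_apply Λ i j t) ?_
    ((htr j hj).integrableOn_transition h.toIsGenerator i)
  simp only [Matrix.mul_apply]
  refine integrable_finsetSum _ fun k _ => ?_
  rcases le_or_gt (ℓ k) (ℓ j) with hkj | hkj
  · exact ((htr k (hkj.trans hj)).integrableOn_transition h.toIsGenerator i).mul_const _
  · simp [h.rate_eq_zero k j (by omega) (by omega)]

theorem tendsto_vecMul_transition_apply (h : IsSequentialGenerator Λ ℓ) {m : ℕ}
    (htr : ∀ i, ℓ i ≤ m → IsTransient Λ i) (v : E → ℝ) {j : E} (hj : ℓ j ≤ m) :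
    Tendsto (fun t => (v ᵥ* transition Λ t) j) atTop (𝓝 0) := by
  simpa [Matrix.vecMul, dotProduct] using tendsto_finsetSum Finset.univ
    fun i _ => (h.tendsto_transition_apply htr i hj).const_mul (v i)

end IsSequentialGenerator

/-- The diagonal projection onto the states of level at most `m`. -/
def levelProj (ℓ : E → ℕ) (m : ℕ) : Matrix E E ℝ :=
  Matrix.diagonal fun i => if ℓ i ≤ m then 1 else 0

/-- The part of `Λ` that consists of the rates from level `m` to level `m + 1`, which is the block
`D m` of a block bidiagonal generator. -/
def exitRate (Λ : Matrix E E ℝ) (ℓ : E → ℕ) (m : ℕ) : Matrix E E ℝ :=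
  Matrix.of fun i j => if ℓ i = m ∧ ℓ j = m + 1 then Λ i j else 0

@[simp]
theorem levelProj_mulVec_apply (ℓ : E → ℕ) (m : ℕ) (w : E → ℝ) (i : E) :
    (levelProj ℓ m *ᵥ w) i = if ℓ i ≤ m then w i else 0 := by
  simp [levelProj, Matrix.mulVec_diagonal]

@[simp]
theorem vecMul_levelProj_apply (ℓ : E → ℕ) (m : ℕ) (v : E → ℝ) (i : E) :
    (v ᵥ* levelProj ℓ m) i = if ℓ i ≤ m then v i else 0 := by
  simp [levelProj, Matrix.vecMul_diagonal]

omit [DecidableEq E] in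
theorem IsGenerator.exitRate_nonneg (hΛ : IsGenerator Λ) (ℓ : E → ℕ) (m : ℕ) (i j : E) :
    0 ≤ exitRate Λ ℓ m i j := by
  rw [exitRate, Matrix.of_apply]
  split_ifs with hij
  · exact hΛ.rate_nonneg i j (by rintro rfl; omega)
  · exact le_rfl

omit [DecidableEq E] in
theorem IsGenerator.exitRate_mulVec_nonneg (hΛ : IsGenerator Λ) (ℓ : E → ℕ) (m : ℕ) {w : E → ℝ}
    (hw : 0 ≤ w) : 0 ≤ exitRate Λ ℓ m *ᵥ w :=
  fun i => dotProduct_nonneg_of_nonneg (hΛ.exitRate_nonneg ℓ m i) hw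

omit [DecidableEq E] in
theorem exitRate_mulVec_apply_eq_zero {m : ℕ} {i : E} (hi : ℓ i ≠ m) (w : E → ℝ) :
    (exitRate Λ ℓ m *ᵥ w) i = 0 := by
  simp [exitRate, Matrix.mulVec, dotProduct, hi]

theorem IsSequentialGenerator.levelProj_mul_sub_mul_levelProj (h : IsSequentialGenerator Λ ℓ)
    (m : ℕ) : levelProj ℓ m * Λ - Λ * levelProj ℓ m = exitRate Λ ℓ m := by
  ext i j
  simp only [levelProj, exitRate, Matrix.sub_apply, Matrix.diagonal_mul, Matrix.mul_diagonal,
    Matrix.of_apply]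
  by_cases hzero : ℓ j ≠ ℓ i ∧ ℓ j ≠ ℓ i + 1
  · simp [h.rate_eq_zero i j hzero.1 hzero.2]
  · split_ifs <;> first | omega | ring

/-- The mass lost at level `≤ m` is what jumps from level `m` to level `m + 1`. -/
theorem IsSequentialGenerator.hasDerivAt_dotProduct_levelProj_mulVec
    (h : IsSequentialGenerator Λ ℓ) (m : ℕ) {p q : ℝ → E → ℝ} {t : ℝ}
    (hp : HasDerivAt p (p t ᵥ* Λ) t) (hq : HasDerivAt q (-(Λ *ᵥ q t)) t) :
    HasDerivAt (fun t => p t ⬝ᵥ (levelProj ℓ m *ᵥ q t))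
      (-(p t ⬝ᵥ (exitRate Λ ℓ m *ᵥ q t))) t := by
  have hproj : HasDerivAt (fun t => levelProj ℓ m *ᵥ q t) (levelProj ℓ m *ᵥ -(Λ *ᵥ q t)) t :=
    ((levelProj ℓ m).mulVecLin.toContinuousLinearMap.hasFDerivAt).comp_hasDerivAt t hq
  refine (hasDerivAt_dotProduct hp hproj).congr_deriv ?_
  rw [← h.levelProj_mul_sub_mul_levelProj, Matrix.sub_mulVec, dotProduct_sub, Matrix.mulVec_neg,
    dotProduct_neg, ← Matrix.dotProduct_mulVec, Matrix.mulVec_mulVec, Matrix.mulVec_mulVec]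
  ring

end Sequential

section Rows

variable {E : Type*} [Fintype E] [DecidableEq E] {Λ : Matrix E E ℝ} {ℓ : E → ℕ} {π : E → ℝ}
  {t : ℕ → ℝ≥0} {m : ℕ}

/-- The row vector `π e^{Λ y 0} D 0 ⋯ e^{Λ y (m-1)} D (m-1)` on the whole state space, where
`D k = exitRate Λ ℓ k`. -/
noncomputable def pathRow (Λ : Matrix E E ℝ) (ℓ : E → ℕ) (π : E → ℝ) :
    (m : ℕ) → (Fin m → ℝ) → E → ℝ
  | 0, _ => π
  | m + 1, y => (pathRow Λ ℓ π m (Fin.init y) ᵥ* transition Λ (y (Fin.last m))) ᵥ* exitRate Λ ℓ m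

/-- The (defective) law at time `c` of the process that starts from `π` and is killed, for each
`k < m`, if its level exceeds `k` at time `t k`. It is meant for `t 0 ≤ ⋯ ≤ t (m-1) ≤ c`. -/
noncomputable def survivalRow (Λ : Matrix E E ℝ) (ℓ : E → ℕ) (π : E → ℝ) (t : ℕ → ℝ≥0) :
    ℕ → ℝ → E → ℝ
  | 0, c => π ᵥ* transition Λ c
  | m + 1, c => (survivalRow Λ ℓ π t m (t m) ᵥ* levelProj ℓ m) ᵥ* transition Λ (c - t m)

@[fun_prop]
theorem continuous_pathRow (Λ : Matrix E E ℝ) (ℓ : E → ℕ) (π : E → ℝ) (m : ℕ) :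
    Continuous (pathRow Λ ℓ π m) := by
  induction m with
  | zero => exact continuous_const
  | succ m ih =>
    have hinit : Continuous fun y : Fin (m + 1) → ℝ => pathRow Λ ℓ π m (Fin.init y) :=
      ih.comp (continuous_pi fun k => continuous_apply _)
    exact (hinit.matrix_vecMul (by fun_prop)).matrix_vecMul continuous_const

theorem IsGenerator.pathRow_nonneg (hΛ : IsGenerator Λ) (hπ : 0 ≤ π) {y : Fin m → ℝ}
    (hy : ∀ k, 0 ≤ y k) : 0 ≤ pathRow Λ ℓ π m y := by
  induction m with
  | zero => exact hπ
  | succ m ih =>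
    have hinit : 0 ≤ pathRow Λ ℓ π m (Fin.init y) := ih fun k => hy k.castSucc
    exact fun j => dotProduct_nonneg_of_nonneg (hΛ.vecMul_transition_nonneg hinit (hy (Fin.last m)))
      fun i => hΛ.exitRate_nonneg ℓ m i j

theorem hasDerivAt_survivalRow (Λ : Matrix E E ℝ) (ℓ : E → ℕ) (π : E → ℝ) (t : ℕ → ℝ≥0) (m : ℕ)
    (c : ℝ) : HasDerivAt (survivalRow Λ ℓ π t m) (survivalRow Λ ℓ π t m c ᵥ* Λ) c := by
  cases m with
  | zero => exact hasDerivAt_vecMul_transition Λ π c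
  | succ m => exact (hasDerivAt_vecMul_transition Λ _ (c - t m)).comp_sub_const c _

theorem IsGenerator.survivalRow_nonneg (hΛ : IsGenerator Λ) (hπ : 0 ≤ π) (ht : Monotone t) {c : ℝ}
    (hc : 0 ≤ c) (htc : ∀ k < m, t k ≤ c) : 0 ≤ survivalRow Λ ℓ π t m c := by
  induction m generalizing c with
  | zero => exact hΛ.vecMul_transition_nonneg hπ hc
  | succ m ih =>
    refine hΛ.vecMul_transition_nonneg (fun i => ?_) (sub_nonneg.2 (htc m m.lt_succ_self))
    rw [vecMul_levelProj_apply]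
    split_ifs
    · exact ih (t m).coe_nonneg (fun k hk => NNReal.coe_le_coe.2 (ht hk.le)) i
    · exact le_rfl

theorem IsSequentialGenerator.tendsto_survivalRow_dotProduct_levelProj_mulVec
    (h : IsSequentialGenerator Λ ℓ) (htr : ∀ i, ℓ i ≤ m → IsTransient Λ i) (π : E → ℝ)
    (t : ℕ → ℝ≥0) (w : E → ℝ) :
    Tendsto (fun c => survivalRow Λ ℓ π t m c ⬝ᵥ (levelProj ℓ m *ᵥ w)) atTop (𝓝 0) := by
  have hlim (v : E → ℝ) (s : ℝ) :
      Tendsto (fun c => (v ᵥ* transition Λ (c - s)) ⬝ᵥ (levelProj ℓ m *ᵥ w)) atTop (𝓝 0) := by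
    rw [← Finset.sum_const_zero (s := (Finset.univ : Finset E))]
    refine tendsto_finsetSum _ fun j _ => ?_
    rw [levelProj_mulVec_apply]
    split_ifs with hj
    · simpa [sub_eq_add_neg] using ((h.tendsto_vecMul_transition_apply htr v hj).comp
        (tendsto_atTop_add_const_right _ (-s) tendsto_id)).mul_const (w j)
    · simp
  cases m with
  | zero => simpa [survivalRow] using hlim π 0
  | succ m => exact hlim _ (t m)

end Rows

section Integration

theorem setLIntegral_Ioc_of_hasDerivAt_neg {f f' : ℝ → ℝ} {a b : ℝ} (hab : a ≤ b)
    (hderiv : ∀ x ∈ Set.Icc a b, HasDerivAt f (-f' x) x) (hf' : ∀ x ∈ Set.Ioc a b, 0 ≤ f' x) :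
    ∫⁻ x in Set.Ioc a b, ENNReal.ofReal (f' x) = ENNReal.ofReal (f a - f b) := by
  have hneg (x : ℝ) (hx : x ∈ Set.Icc a b) : HasDerivAt (-f) (f' x) x := by
    simpa using (hderiv x hx).neg
  have hint : IntegrableOn f' (Set.Ioc a b) :=
    intervalIntegral.integrableOn_deriv_of_nonneg (HasDerivAt.continuousOn hneg)
      (fun x hx => hneg x (Set.Ioo_subset_Icc_self hx)) fun x hx =>
      hf' x (Set.Ioo_subset_Ioc_self hx)
  rw [← ofReal_integral_eq_lintegral_ofReal hint (ae_restrict_of_forall_mem measurableSet_Ioc hf'),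
    ← intervalIntegral.integral_of_le hab,
    intervalIntegral.integral_eq_sub_of_hasDerivAt (f := -f) (by rwa [Set.uIcc_of_le hab])
      ((intervalIntegrable_iff_integrableOn_Ioc_of_le hab).2 hint)]
  rw [Pi.neg_apply, Pi.neg_apply, neg_sub_neg]

theorem setLIntegral_Ioi_of_hasDerivAt_neg {f f' : ℝ → ℝ} {a : ℝ}
    (hderiv : ∀ x ∈ Set.Ici a, HasDerivAt f (-f' x) x) (hf' : ∀ x ∈ Set.Ioi a, 0 ≤ f' x)
    (hlim : Tendsto f atTop (𝓝 0)) :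
    ∫⁻ x in Set.Ioi a, ENNReal.ofReal (f' x) = ENNReal.ofReal (f a) := by
  have hneg (x : ℝ) (hx : x ∈ Set.Ici a) : HasDerivAt (-f) (f' x) x := by
    simpa using (hderiv x hx).neg
  have hlim' : Tendsto (-f) atTop (𝓝 0) := by
    rw [← neg_zero]
    exact hlim.neg
  rw [← ofReal_integral_eq_lintegral_ofReal (integrableOn_Ioi_deriv_of_nonneg' hneg hf' hlim')
    (ae_restrict_of_forall_mem measurableSet_Ioi hf'),
    integral_Ioi_of_hasDerivAt_of_nonneg' hneg hf' hlim']
  simp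

theorem lintegral_snoc {m : ℕ} {F : (Fin (m + 1) → ℝ) → ℝ≥0∞} (hF : Measurable F) :
    ∫⁻ y, F y = ∫⁻ y : Fin m → ℝ, ∫⁻ s : ℝ, F (Fin.snoc y s) := by
  have e := volume_preserving_piFinSuccAbove (fun _ : Fin (m + 1) => ℝ) (Fin.last m)
  rw [← e.symm.lintegral_comp hF, Measure.volume_eq_prod, lintegral_prod_symm]
  · simp [MeasurableEquiv.piFinSuccAbove, Fin.snocEquiv]
  · exact (hF.comp (MeasurableEquiv.measurable _)).aemeasurable

theorem measurable_snoc_sub_sum {m : ℕ} :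
    Measurable fun p : (Fin m → ℝ) × ℝ =>
      (Fin.snoc p.1 (p.2 - ∑ k, p.1 k) : Fin (m + 1) → ℝ) := by
  refine measurable_pi_iff.2 (Fin.lastCases ?_ fun k => ?_)
  · simp only [Fin.snoc_last]
    fun_prop
  · simp only [Fin.snoc_castSucc]
    fun_prop

/-- Integration in the coordinates `(y 0, …, y (m-1), u)` with `u = y 0 + ⋯ + y m`. -/
theorem lintegral_snoc_sub_sum {m : ℕ} {F : (Fin (m + 1) → ℝ) → ℝ≥0∞} (hF : Measurable F) :
    ∫⁻ y, F y = ∫⁻ u : ℝ, ∫⁻ y : Fin m → ℝ, F (Fin.snoc y (u - ∑ k, y k)) := by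
  rw [lintegral_snoc hF, lintegral_lintegral_swap
    (f := fun u y => F (Fin.snoc y (u - ∑ k, y k)))
    (hF.comp (measurable_snoc_sub_sum.comp measurable_swap)).aemeasurable]
  exact lintegral_congr fun y =>
    (lintegral_sub_right_eq_self (fun s => F (Fin.snoc y s)) (∑ k, y k)).symm

/-- The vector of partial sums: if `y k` is the time spent at level `k`, then `partialSums y k` is
the time at which level `k` is left. -/
def partialSums {n : ℕ} (y : Fin n → ℝ) (k : Fin n) : ℝ :=
  ∑ l ∈ Finset.Iic k, y l

variable {t : ℕ → ℝ≥0} {m : ℕ} {I : Set ℝ}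

/-- The vectors of sojourn times `y ≥ 0` for which each level `k < m` is left after time `t k`, and
level `m - 1` is left at a time in `I`. -/
def partialSumRegion (t : ℕ → ℝ≥0) (m : ℕ) (I : Set ℝ) : Set (Fin m → ℝ) :=
  {y | (∀ k, 0 ≤ y k) ∧ (∀ k : Fin m, t k < partialSums y k) ∧ ∑ k, y k ∈ I}

theorem measurableSet_partialSumRegion (t : ℕ → ℝ≥0) (m : ℕ) (hI : MeasurableSet I) :
    MeasurableSet (partialSumRegion t m I) := by
  simp only [partialSumRegion, partialSums, Set.ofPred_and, Set.ofPred_forall]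
  have hsum : Measurable fun y : Fin m → ℝ => ∑ k, y k := by fun_prop
  exact (MeasurableSet.iInter fun k => measurableSet_le measurable_const (by fun_prop)).inter
    ((MeasurableSet.iInter fun k => measurableSet_lt measurable_const (by fun_prop)).inter
      (hsum hI))

theorem snoc_sub_sum_mem_partialSumRegion {y : Fin m → ℝ} {u : ℝ} :
    (Fin.snoc y (u - ∑ k, y k) : Fin (m + 1) → ℝ) ∈ partialSumRegion t (m + 1) I ↔
      u ∈ Set.Ioi (t m : ℝ) ∩ I ∧ y ∈ partialSumRegion t m (Set.Iic u) := by
  simp only [partialSumRegion, partialSums, Set.mem_ofPred_eq, Fin.forall_fin_succ',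
    Fin.snoc_castSucc, Fin.snoc_last, Fin.sum_Iic_castSucc, Fin.sum_univ_castSucc,
    Fin.val_castSucc, Fin.val_last, sub_nonneg, add_sub_cancel, Set.mem_inter_iff, Set.mem_Ioi,
    Set.mem_Iic]
  have hlast : ∑ l ∈ Finset.Iic (Fin.last m), (Fin.snoc y (u - ∑ k, y k) : Fin (m + 1) → ℝ) l
      = u := by
    rw [← Fin.top_eq_last, Finset.Iic_top, Fin.sum_univ_castSucc]
    simp
  rw [hlast]
  tauto

theorem setLIntegral_partialSumRegion_succ (hI : MeasurableSet I)
    {F : (Fin (m + 1) → ℝ) → ℝ≥0∞} (hF : Measurable F) :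
    ∫⁻ y in partialSumRegion t (m + 1) I, F y = ∫⁻ u in Set.Ioi (t m : ℝ) ∩ I,
      ∫⁻ y in partialSumRegion t m (Set.Iic u), F (Fin.snoc y (u - ∑ k, y k)) := by
  have hU := measurableSet_partialSumRegion t (m + 1) hI
  rw [← lintegral_indicator hU, lintegral_snoc_sub_sum (hF.indicator hU),
    ← lintegral_indicator (measurableSet_Ioi.inter hI)]
  refine lintegral_congr fun u => ?_
  by_cases hu : u ∈ Set.Ioi (t m : ℝ) ∩ I
  · rw [Set.indicator_of_mem hu,
      ← lintegral_indicator (measurableSet_partialSumRegion t m measurableSet_Iic)]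
    classical
    exact lintegral_congr fun y =>
      if_congr (snoc_sub_sum_mem_partialSumRegion.trans (and_iff_right hu)) rfl rfl
  · simp only [Set.indicator, snoc_sub_sum_mem_partialSumRegion, hu, false_and, if_false,
      lintegral_zero]

end Integration

section Density

variable {E : Type*} [Fintype E] [DecidableEq E] {Λ : Matrix E E ℝ} {ℓ : E → ℕ} {π : E → ℝ}
  {t : ℕ → ℝ≥0} {m : ℕ}

theorem setLIntegral_pathRow_succ (Λ : Matrix E E ℝ) (ℓ : E → ℕ) (π : E → ℝ) (t : ℕ → ℝ≥0)
    (m : ℕ) {I : Set ℝ} (hI : MeasurableSet I) {q : ℝ → E → ℝ} (hq : Continuous q) :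
    ∫⁻ y in partialSumRegion t (m + 1) I,
        ENNReal.ofReal (pathRow Λ ℓ π (m + 1) y ⬝ᵥ q (∑ k, y k)) =
      ∫⁻ u in Set.Ioi (t m : ℝ) ∩ I, ∫⁻ y in partialSumRegion t m (Set.Iic u),
        ENNReal.ofReal ((pathRow Λ ℓ π m y ᵥ* transition Λ (u - ∑ k, y k)) ⬝ᵥ
          (exitRate Λ ℓ m *ᵥ q u)) := by
  have hcont : Continuous fun y : Fin (m + 1) → ℝ =>
      pathRow Λ ℓ π (m + 1) y ⬝ᵥ q (∑ k, y k) :=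
    (continuous_pathRow Λ ℓ π (m + 1)).dotProduct (hq.comp (by fun_prop))
  rw [setLIntegral_partialSumRegion_succ hI hcont.measurable.ennreal_ofReal]
  simp only [pathRow, Fin.init_snoc, Fin.snoc_last, Fin.sum_univ_castSucc, Fin.snoc_castSucc,
    add_sub_cancel, Matrix.dotProduct_mulVec]

namespace IsSequentialGenerator

theorem setLIntegral_survivalRow_dotProduct_exitRate_mulVec (h : IsSequentialGenerator Λ ℓ)
    (hπ : 0 ≤ π) (ht : Monotone t) {c : ℝ} (hc : t m ≤ c) {w : E → ℝ} (hw : 0 ≤ w)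
    (hwm : ∀ i, ℓ i ≤ m → w i = 0) :
    ∫⁻ u in Set.Ioc (t m : ℝ) c, ENNReal.ofReal
        (survivalRow Λ ℓ π t m u ⬝ᵥ (exitRate Λ ℓ m *ᵥ (transition Λ (c - u) *ᵥ w))) =
      ENNReal.ofReal (survivalRow Λ ℓ π t (m + 1) c ⬝ᵥ w) := by
  set q : ℝ → E → ℝ := fun u => transition Λ (c - u) *ᵥ w
  calc ∫⁻ u in Set.Ioc (t m : ℝ) c,
          ENNReal.ofReal (survivalRow Λ ℓ π t m u ⬝ᵥ (exitRate Λ ℓ m *ᵥ q u))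
      = ENNReal.ofReal (survivalRow Λ ℓ π t m (t m) ⬝ᵥ (levelProj ℓ m *ᵥ q (t m)) -
          survivalRow Λ ℓ π t m c ⬝ᵥ (levelProj ℓ m *ᵥ q c)) :=
        setLIntegral_Ioc_of_hasDerivAt_neg
          (f := fun u => survivalRow Λ ℓ π t m u ⬝ᵥ (levelProj ℓ m *ᵥ q u)) hc
          (fun u _ => h.hasDerivAt_dotProduct_levelProj_mulVec m
            (hasDerivAt_survivalRow Λ ℓ π t m u) (hasDerivAt_transition_sub_mulVec Λ w c u))
          fun u hu => dotProduct_nonneg_of_nonneg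
            (h.survivalRow_nonneg hπ ht ((t m).coe_nonneg.trans hu.1.le)
              fun k hk => (NNReal.coe_le_coe.2 (ht hk.le)).trans hu.1.le)
            (h.exitRate_mulVec_nonneg ℓ m (h.transition_mulVec_nonneg hw (sub_nonneg.2 hu.2)))
    _ = ENNReal.ofReal (survivalRow Λ ℓ π t (m + 1) c ⬝ᵥ w) := by
        have hqc : levelProj ℓ m *ᵥ q c = 0 := by
          ext i
          simp +contextual [q, hwm]
        rw [hqc, dotProduct_zero, sub_zero, survivalRow, ← Matrix.dotProduct_mulVec,
          ← Matrix.dotProduct_mulVec]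

theorem setLIntegral_pathRow_vecMul_transition (h : IsSequentialGenerator Λ ℓ) (hπ : 0 ≤ π)
    (ht : Monotone t) {c : ℝ} (hc : 0 ≤ c) (htc : ∀ k < m, t k ≤ c) {w : E → ℝ} (hw : 0 ≤ w)
    (hwm : ∀ i, ℓ i < m → w i = 0) :
    ∫⁻ y in partialSumRegion t m (Set.Iic c),
        ENNReal.ofReal ((pathRow Λ ℓ π m y ᵥ* transition Λ (c - ∑ k, y k)) ⬝ᵥ w) =
      ENNReal.ofReal (survivalRow Λ ℓ π t m c ⬝ᵥ w) := by
  induction m generalizing c w with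
  | zero =>
    have huniv : partialSumRegion t 0 (Set.Iic c) = Set.univ := by
      simp [partialSumRegion, hc]
    simp [huniv, pathRow, survivalRow, volume_pi]
  | succ m ih =>
    simp only [← Matrix.dotProduct_mulVec]
    rw [setLIntegral_pathRow_succ Λ ℓ π t m measurableSet_Iic
      (q := fun u => transition Λ (c - u) *ᵥ w)
      (((continuous_transition Λ).comp (by fun_prop)).matrix_mulVec continuous_const),
      Set.Ioi_inter_Iic,
      ← h.setLIntegral_survivalRow_dotProduct_exitRate_mulVec hπ ht (htc m m.lt_succ_self) hw
        fun i hi => hwm i (Nat.lt_succ_of_le hi)]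
    exact setLIntegral_congr_fun measurableSet_Ioc fun u hu =>
      ih ((t m).coe_nonneg.trans hu.1.le)
        (fun k hk => (NNReal.coe_le_coe.2 (ht hk.le)).trans hu.1.le)
        (h.exitRate_mulVec_nonneg ℓ m (h.transition_mulVec_nonneg hw (sub_nonneg.2 hu.2)))
        fun i hi => exitRate_mulVec_apply_eq_zero hi.ne _

theorem setLIntegral_sum_pathRow (h : IsSequentialGenerator Λ ℓ) (hπ : 0 ≤ π)
    (htr : ∀ i, ℓ i ≤ m → IsTransient Λ i) (ht : Monotone t) :
    ∫⁻ y in partialSumRegion t (m + 1) Set.univ,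
        ENNReal.ofReal (pathRow Λ ℓ π (m + 1) y ⬝ᵥ 1) =
      ENNReal.ofReal (survivalRow Λ ℓ π t m (t m) ⬝ᵥ (levelProj ℓ m *ᵥ 1)) := by
  have htm (u : ℝ) (hu : t m ≤ u) : ∀ k < m, t k ≤ u :=
    fun k hk => (NNReal.coe_le_coe.2 (ht hk.le)).trans hu
  have hE0 : 0 ≤ exitRate Λ ℓ m *ᵥ 1 := h.exitRate_mulVec_nonneg ℓ m zero_le_one
  have hderiv (u : ℝ) :
      HasDerivAt (fun u => survivalRow Λ ℓ π t m u ⬝ᵥ (levelProj ℓ m *ᵥ (1 : E → ℝ)))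
        (-(survivalRow Λ ℓ π t m u ⬝ᵥ (exitRate Λ ℓ m *ᵥ 1))) u :=
    h.hasDerivAt_dotProduct_levelProj_mulVec m (q := fun _ => 1)
      (hasDerivAt_survivalRow Λ ℓ π t m u)
      ((hasDerivAt_const u 1).congr_deriv (by rw [h.mulVec_one, neg_zero]))
  have hlim : Tendsto (fun u => survivalRow Λ ℓ π t m u ⬝ᵥ (levelProj ℓ m *ᵥ (1 : E → ℝ))) atTop
      (𝓝 0) :=
    h.tendsto_survivalRow_dotProduct_levelProj_mulVec htr π t 1
  rw [setLIntegral_pathRow_succ Λ ℓ π t m .univ (q := fun _ => 1) continuous_const, Set.inter_univ,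
    ← setLIntegral_Ioi_of_hasDerivAt_neg (fun u _ => hderiv u)
      (fun u hu => dotProduct_nonneg_of_nonneg
        (h.survivalRow_nonneg hπ ht ((t m).coe_nonneg.trans (le_of_lt hu)) (htm u (le_of_lt hu)))
        hE0) hlim]
  exact setLIntegral_congr_fun measurableSet_Ioi fun u hu =>
    h.setLIntegral_pathRow_vecMul_transition hπ ht ((t m).coe_nonneg.trans (le_of_lt hu))
      (htm u (le_of_lt hu)) hE0 fun i hi => exitRate_mulVec_apply_eq_zero hi.ne _

end IsSequentialGenerator

end Density

section PartialSums

variable {n : ℕ}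

theorem injective_partialSums : Function.Injective (partialSums (n := n)) := by
  intro y z hyz
  funext k
  induction k using WellFoundedLT.induction with
  | _ k ih =>
    have hk : partialSums y k = partialSums z k := congrFun hyz k
    rw [partialSums, partialSums, ← Finset.Iio_insert, Finset.sum_insert (by simp),
      Finset.sum_insert (by simp),
      Finset.sum_congr rfl fun l hl => ih l (Finset.mem_Iio.1 hl)] at hk
    exact add_right_cancel hk

theorem measurableEmbedding_partialSums : MeasurableEmbedding (partialSums (n := n)) := by
  refine Measurable.measurableEmbedding ?_ injective_partialSums
  unfold partialSums
  fun_prop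

theorem monotone_partialSums {y : Fin n → ℝ} (hy : ∀ k, 0 ≤ y k) : Monotone (partialSums y) :=
  fun _ _ hkl => Finset.sum_le_sum_of_subset_of_nonneg (Finset.Iic_subset_Iic.2 hkl)
    fun i _ _ => hy i

theorem measurableSet_forall_lt_partialSums (n : ℕ) (t : ℕ → ℝ≥0) :
    MeasurableSet {y : Fin n → ℝ | ∀ k : Fin n, (t k : ℝ) < partialSums y k} := by
  rw [Set.ofPred_forall]
  exact MeasurableSet.iInter fun k => measurableSet_lt measurable_const
    ((measurable_pi_apply k).comp measurableEmbedding_partialSums.measurable)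

theorem partialSums_nonneg {y : Fin n → ℝ} (hy : ∀ k, 0 ≤ y k) (k : Fin n) :
    0 ≤ partialSums y k :=
  Finset.sum_nonneg fun i _ => hy i

theorem partialSums_pos {y : Fin n → ℝ} (hy : ∀ k, 0 < y k) (k : Fin n) : 0 < partialSums y k :=
  Finset.sum_pos (fun i _ => hy i) Finset.nonempty_Iic

/-- The running maximum `max (x 0) … (x k) 0`, as a sequence. -/
noncomputable def runningMax (x : Fin n → ℝ) (k : ℕ) : ℝ≥0 :=
  (Finset.univ.filter fun l : Fin n => (l : ℕ) ≤ k).sup fun l => (x l).toNNReal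

theorem monotone_runningMax (x : Fin n → ℝ) : Monotone (runningMax x) :=
  fun _ _ hkl => Finset.sup_mono
    (Finset.monotone_filter_right _ fun _ _ hi => hi.trans hkl)

theorem forall_runningMax_lt_iff {s : Fin n → ℝ} (hs : Monotone s) (hpos : ∀ k, 0 < s k)
    (x : Fin n → ℝ) : (∀ k : Fin n, (runningMax x k : ℝ) < s k) ↔ ∀ k, x k < s k := by
  have hlt (k : Fin n) : (runningMax x k : ℝ) < s k ↔ ∀ l ≤ k, x l < s k := by
    rw [← Real.lt_toNNReal_iff_coe_lt, runningMax,
      Finset.sup_lt_iff (bot_lt_iff_ne_bot.2 (by simpa using hpos k))]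
    simp [Real.toNNReal_lt_toNNReal_iff (hpos k)]
  simp only [hlt]
  exact ⟨fun h k => h k k le_rfl, fun h k l hlk => (h l).trans_le (hs hlk)⟩

theorem borel_pi_eq_generateFrom_pi_Ioi (n : ℕ) :
    (MeasurableSpace.pi : MeasurableSpace (Fin n → ℝ)) = MeasurableSpace.generateFrom
      (Set.pi Set.univ '' Set.pi Set.univ fun _ : Fin n => Set.range (Set.Ioi (α := ℝ))) := by
  rw [← generateFrom_pi_eq]
  · congr 1
    ext1 _
    exact (BorelSpace.measurable_eq (α := ℝ)).trans (borel_eq_generateFrom_Ioi ℝ)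
  · exact fun _ => ⟨fun m => Set.Ioi (-m : ℝ), fun m => ⟨_, rfl⟩,
      Set.eq_univ_of_forall fun x => Set.mem_iUnion.2
        ((exists_nat_gt (-x)).imp fun _ hm => neg_lt.1 hm)⟩

/-- Orthants with arbitrary corners reduce to orthants with ordered nonnegative corners because the
partial sums are positive and increasing. -/
theorem ext_of_forall_lt_partialSums {μ ν : Measure (Fin n → ℝ)} [IsFiniteMeasure μ]
    (hμ : ∀ᵐ y ∂μ, (∀ k, 0 ≤ y k) ∧ ∀ k, 0 < partialSums y k)
    (hν : ∀ᵐ y ∂ν, (∀ k, 0 ≤ y k) ∧ ∀ k, 0 < partialSums y k)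
    (hμν : ∀ t : ℕ → ℝ≥0, Monotone t → μ {y | ∀ k : Fin n, (t k : ℝ) < partialSums y k} =
      ν {y | ∀ k : Fin n, (t k : ℝ) < partialSums y k}) : μ = ν := by
  have hpi {ρ : Measure (Fin n → ℝ)}
      (hρ : ∀ᵐ y ∂ρ, (∀ k, 0 ≤ y k) ∧ ∀ k, 0 < partialSums y k) (x : Fin n → ℝ) :
      ρ.map partialSums (Set.pi Set.univ fun k => Set.Ioi (x k)) =
        ρ {y | ∀ k : Fin n, (runningMax x k : ℝ) < partialSums y k} := by
    rw [measurableEmbedding_partialSums.map_apply]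
    refine measure_congr ?_
    filter_upwards [hρ] with y ⟨hy, hpos⟩
    have h := forall_runningMax_lt_iff (monotone_partialSums hy) hpos x
    exact propext (Set.mem_univ_pi.trans h.symm)
  have huniv {ρ : Measure (Fin n → ℝ)}
      (hρ : ∀ᵐ y ∂ρ, (∀ k, 0 ≤ y k) ∧ ∀ k, 0 < partialSums y k) :
      ρ.map partialSums Set.univ =
        ρ {y | ∀ k : Fin n, ((0 : ℕ → ℝ≥0) k : ℝ) < partialSums y k} := by
    rw [measurableEmbedding_partialSums.map_apply]
    refine measure_congr ?_
    filter_upwards [hρ] with y ⟨_, hpos⟩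
    exact propext (iff_of_true trivial hpos)
  refine measurableEmbedding_partialSums.map_injective ?_
  have : IsFiniteMeasure (μ.map partialSums) := μ.isFiniteMeasure_map partialSums
  refine ext_of_generate_finite _ (borel_pi_eq_generateFrom_pi_Ioi n)
    (IsPiSystem.pi fun _ => isPiSystem_Ioi) ?_ ?_
  · rintro _ ⟨s, hs, rfl⟩
    choose x hx using fun k => hs k (Set.mem_univ k)
    obtain rfl : (fun k => Set.Ioi (x k)) = s := funext hx
    rw [hpi hμ, hpi hν, hμν _ (monotone_runningMax x)]
  · rw [huniv hμ, huniv hν, hμν 0 monotone_const]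

end PartialSums

section SojournTime

variable {g : ℝ≥0 → ℕ}

/-- The time `∫₀^∞ 1{g s = k} ds` that the path `g` spends at `k`. -/
noncomputable def sojournTime (g : ℝ≥0 → ℕ) (k : ℕ) : ℝ≥0∞ :=
  ∫⁻ s in Set.Ici (0 : ℝ), ({k} : Set ℕ).indicator (fun _ => (1 : ℝ≥0∞)) (g s.toNNReal)

theorem sum_sojournTime (hg : Monotone g) (k : ℕ) :
    ∑ l ∈ Finset.Iic k, sojournTime g l = volume {s : ℝ | 0 ≤ s ∧ g s.toNNReal ≤ k} := by
  have hmeas : Measurable fun s : ℝ => g s.toNNReal :=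
    Monotone.measurable fun s t hst => hg (Real.toNNReal_le_toNNReal hst)
  have hset : MeasurableSet {s : ℝ | g s.toNNReal ≤ k} := hmeas (measurableSet_Iic (a := k))
  have hinter : {s : ℝ | 0 ≤ s ∧ g s.toNNReal ≤ k} = {s | g s.toNNReal ≤ k} ∩ Set.Ici 0 := by
    ext
    simp [and_comm]
  unfold sojournTime
  rw [← lintegral_finsetSum, hinter, ← Measure.restrict_apply hset, ← lintegral_indicator_one hset]
  · refine lintegral_congr fun s => ?_
    simp only [Set.indicator_apply, Set.mem_singleton_iff, Finset.sum_ite_eq, Finset.mem_Iic,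
      Set.mem_ofPred_eq, Pi.one_apply]
  · exact fun l _ => (measurable_const.indicator (measurableSet_singleton l)).comp hmeas

theorem sum_sojournTime_le (hg : Monotone g) {k : ℕ} {t : ℝ≥0} (hk : k < g t) :
    ∑ l ∈ Finset.Iic k, sojournTime g l ≤ t := by
  calc ∑ l ∈ Finset.Iic k, sojournTime g l = volume {s : ℝ | 0 ≤ s ∧ g s.toNNReal ≤ k} :=
        sum_sojournTime hg k
    _ ≤ volume (Set.Ico (0 : ℝ) t) := by
        refine measure_mono fun s hs => ⟨hs.1, ?_⟩
        by_contra! hts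
        exact (hk.trans_le (hg (NNReal.le_toNNReal_of_coe_le hts))).not_ge hs.2
    _ = t := by simp

theorem lt_sum_sojournTime (hg : Monotone g) {k : ℕ} {t : ℝ≥0} (hk : g t ≤ k)
    (hrc : ∀ᶠ s in 𝓝[≥] t, g s = g t) : (t : ℝ≥0∞) < ∑ l ∈ Finset.Iic k, sojournTime g l := by
  obtain ⟨u, htu, hu⟩ := (mem_nhdsGE_iff_exists_Ico_subset' (lt_add_one t)).1 hrc
  calc (t : ℝ≥0∞) < u := by exact_mod_cast htu
    _ = volume (Set.Ico (0 : ℝ) u) := by simp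
    _ ≤ volume {s : ℝ | 0 ≤ s ∧ g s.toNNReal ≤ k} := by
        refine measure_mono fun s hs => ⟨hs.1, ?_⟩
        have hsu : s.toNNReal < u := (Real.toNNReal_lt_iff_lt_coe hs.1).2 hs.2
        rcases le_total t s.toNNReal with hts | hst
        · exact (hu ⟨hts, hsu⟩).trans_le hk
        · exact (hg hst).trans hk
    _ = ∑ l ∈ Finset.Iic k, sojournTime g l := (sum_sojournTime hg k).symm

theorem lt_sum_sojournTime_iff (hg : Monotone g) (hrc : ∀ t, ∀ᶠ s in 𝓝[≥] t, g s = g t) (k : ℕ)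
    (t : ℝ≥0) : (t : ℝ≥0∞) < ∑ l ∈ Finset.Iic k, sojournTime g l ↔ g t ≤ k :=
  ⟨fun h => not_lt.1 fun hk => (sum_sojournTime_le hg hk).not_gt h,
    fun hk => lt_sum_sojournTime hg hk (hrc t)⟩

/-- The vector of the times that the path `g` spends at `0, …, n - 1`, in `ℝⁿ`. An infinite sojourn
time is represented by `0`. -/
noncomputable def sojournVec (g : ℝ≥0 → ℕ) (n : ℕ) (k : Fin n) : ℝ :=
  (sojournTime g k).toReal

theorem partialSums_sojournVec {n : ℕ} (hfin : ∀ k < n, sojournTime g k < ∞) (k : Fin n) :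
    partialSums (sojournVec g n) k = (∑ l ∈ Finset.Iic (k : ℕ), sojournTime g l).toReal := by
  rw [ENNReal.toReal_sum fun l hl => (hfin l ((Finset.mem_Iic.1 hl).trans_lt k.isLt)).ne,
    ← Fin.map_valEmbedding_Iic, Finset.sum_map]
  rfl

theorem lt_partialSums_sojournVec_iff {n : ℕ} (hg : Monotone g)
    (hrc : ∀ t, ∀ᶠ s in 𝓝[≥] t, g s = g t) (hfin : ∀ k < n, sojournTime g k < ∞) (k : Fin n)
    (t : ℝ≥0) : (t : ℝ) < partialSums (sojournVec g n) k ↔ g t ≤ k := by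
  have hne : ∑ l ∈ Finset.Iic (k : ℕ), sojournTime g l ≠ ∞ :=
    (ENNReal.sum_lt_top.2 fun l hl => hfin l ((Finset.mem_Iic.1 hl).trans_lt k.isLt)).ne
  rw [partialSums_sojournVec hfin, ← lt_sum_sojournTime_iff hg hrc, ← ENNReal.coe_toNNReal hne,
    ENNReal.coe_lt_coe, ENNReal.coe_toReal, NNReal.coe_lt_coe]

end SojournTime

section PathMeasure

variable {E : Type*} [Fintype E] [DecidableEq E] {Λ : Matrix E E ℝ} {ℓ : E → ℕ} {π : E → ℝ}
  {t : ℕ → ℝ≥0} {m : ℕ}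

/-- The measure on `ℝⁿ` that is concentrated on the nonnegative orthant and has the density
`π e^{Λ y 0} D 0 ⋯ e^{Λ y (n-1)} D (n-1) 1` there, where `D k = exitRate Λ ℓ k`. -/
noncomputable def pathMeasure (Λ : Matrix E E ℝ) (ℓ : E → ℕ) (π : E → ℝ) (n : ℕ) :
    Measure (Fin n → ℝ) :=
  volume.withDensity
    ({y | ∀ k, 0 ≤ y k}.indicator fun y => ENNReal.ofReal (pathRow Λ ℓ π n y ⬝ᵥ 1))

theorem measurableSet_forall_nonneg (n : ℕ) : MeasurableSet {y : Fin n → ℝ | ∀ k, 0 ≤ y k} :=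
  measurableSet_Ici (a := (0 : Fin n → ℝ))

theorem pathMeasure_eq_withDensity_restrict (Λ : Matrix E E ℝ) (ℓ : E → ℕ) (π : E → ℝ) (n : ℕ) :
    pathMeasure Λ ℓ π n = (volume.restrict {y | ∀ k, 0 ≤ y k}).withDensity
      fun y => ENNReal.ofReal (pathRow Λ ℓ π n y ⬝ᵥ 1) :=
  withDensity_indicator (measurableSet_forall_nonneg n) _

theorem ae_pathMeasure_pos (Λ : Matrix E E ℝ) (ℓ : E → ℕ) (π : E → ℝ) (n : ℕ) :
    ∀ᵐ y ∂pathMeasure Λ ℓ π n, ∀ k, 0 < y k := by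
  rw [pathMeasure_eq_withDensity_restrict]
  refine (withDensity_absolutelyContinuous _ _).ae_le ?_
  have hne (k : Fin n) : ∀ᵐ y : Fin n → ℝ, y k ≠ 0 :=
    measure_eq_zero_iff_ae_notMem.1 (Measure.pi_hyperplane _ k 0)
  filter_upwards [ae_restrict_of_ae (ae_all_iff.2 hne),
    ae_restrict_mem (measurableSet_forall_nonneg n)] with y hy hy0 k
  exact lt_of_le_of_ne (hy0 k) (hy k).symm

theorem IsSequentialGenerator.pathMeasure_forall_lt_partialSums (h : IsSequentialGenerator Λ ℓ)
    (hπ : 0 ≤ π) (htr : ∀ i, ℓ i ≤ m → IsTransient Λ i) (ht : Monotone t) :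
    pathMeasure Λ ℓ π (m + 1) {y | ∀ k : Fin (m + 1), (t k : ℝ) < partialSums y k} =
      ENNReal.ofReal (survivalRow Λ ℓ π t m (t m) ⬝ᵥ (levelProj ℓ m *ᵥ 1)) := by
  have hmeas := measurableSet_forall_lt_partialSums (m + 1) t
  rw [pathMeasure_eq_withDensity_restrict, withDensity_apply _ hmeas,
    Measure.restrict_restrict hmeas, ← h.setLIntegral_sum_pathRow hπ htr ht]
  congr 2
  ext y
  simp [partialSumRegion, and_comm]

end PathMeasure

section MarkovJumpProcess

variable {E : Type*} [Fintype E] [DecidableEq E] {Ω : Type*} [MeasurableSpace Ω]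
  {P : Measure Ω} {Λ : Matrix E E ℝ} {ℓ : E → ℕ} {m : ℕ} {π : E → ℝ}
  {X : ℝ≥0 → Ω → E} {t : ℕ → ℝ≥0}

theorem measurableSet_mem_finset {β : Type*} {f : Ω → β} {F : Finset β}
    (hf : ∀ b ∈ F, MeasurableSet {ω | f ω = b}) : MeasurableSet {ω | f ω ∈ F} := by
  have hF : {ω | f ω ∈ F} = ⋃ b ∈ F, f ⁻¹' {b} := (Set.biUnion_preimage_singleton f F).symm
  exact hF ▸ F.measurableSet_biUnion hf

theorem sum_measureReal_eq_and {β : Type*} [IsFiniteMeasure P] {f : Ω → β} {F : Finset β}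
    (hf : ∀ b ∈ F, MeasurableSet {ω | f ω = b}) (p : Ω → Prop) :
    ∑ b ∈ F, P.real {ω | f ω = b ∧ p ω} = P.real {ω | f ω ∈ F ∧ p ω} :=
  calc ∑ b ∈ F, P.real {ω | f ω = b ∧ p ω} = ∑ b ∈ F, (P.restrict {ω | p ω}).real (f ⁻¹' {b}) :=
        Finset.sum_congr rfl fun b hb => (measureReal_restrict_apply (hf b hb)).symm
    _ = (P.restrict {ω | p ω}).real (f ⁻¹' F) := sum_measureReal_preimage_singleton F hf
    _ = P.real {ω | f ω ∈ F ∧ p ω} := measureReal_restrict_apply (measurableSet_mem_finset hf)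

namespace IsMarkovJumpProcess

theorem initial_nonneg (hX : IsMarkovJumpProcess P Λ π X) : 0 ≤ π :=
  fun i => hX.initial i ▸ measureReal_nonneg

theorem ae_eventually_nhdsGE_eq (hX : IsMarkovJumpProcess P Λ π X) :
    ∀ᵐ ω ∂P, ∀ t, ∀ᶠ s in 𝓝[≥] t, X s ω = X t ω := by
  filter_upwards [hX.right_continuous] with ω hω t
  obtain ⟨ε, hε, hs⟩ := hω t
  filter_upwards [Ico_mem_nhdsGE (lt_add_of_pos_right t hε)] with s hst using hs s hst.1 hst.2

theorem measureReal_forall_mem_and_eq_and_eq [IsFiniteMeasure P]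
    (hX : IsMarkovJumpProcess P Λ π X) (ht : Monotone t) (m : ℕ) (B : ℕ → Set E) (s : ℝ≥0)
    (i j : E) :
    P.real {ω | ((∀ k < m, X (t k) ω ∈ B k) ∧ X (t m) ω = i) ∧ X (t m + s) ω = j} =
      P.real {ω | (∀ k < m, X (t k) ω ∈ B k) ∧ X (t m) ω = i} * transition Λ s i j := by
  classical
  let path (ω : Ω) (r : Fin (m + 1)) : E := X (t r) ω
  let F : Finset (Fin (m + 1) → E) :=
    {x | (∀ r : Fin m, x r.castSucc ∈ B r) ∧ x (Fin.last m) = i}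
  have hF (ω : Ω) : path ω ∈ F ↔ (∀ k < m, X (t k) ω ∈ B k) ∧ X (t m) ω = i := by
    simp [F, path, Fin.forall_iff]
  have hpath : ∀ x ∈ F, MeasurableSet {ω | path ω = x} := fun x _ => by
    simp only [funext_iff, Set.ofPred_forall]
    exact MeasurableSet.iInter fun r => hX.measurable _ _
  calc P.real {ω | ((∀ k < m, X (t k) ω ∈ B k) ∧ X (t m) ω = i) ∧ X (t m + s) ω = j}
      = ∑ x ∈ F, P.real {ω | path ω = x ∧ X (t m + s) ω = j} := by
        simp only [sum_measureReal_eq_and hpath, hF]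
    _ = ∑ x ∈ F, P.real {ω | path ω = x ∧ True} * transition Λ s i j := by
        refine Finset.sum_congr rfl fun x hx => ?_
        obtain rfl : x (Fin.last m) = i := (Finset.mem_filter.1 hx).2.2
        simp only [funext_iff, and_true]
        exact hX.markov m (fun r => t r) (fun _ _ hrs => ht hrs) x s j
    _ = P.real {ω | (∀ k < m, X (t k) ω ∈ B k) ∧ X (t m) ω = i} * transition Λ s i j := by
        rw [← Finset.sum_mul, sum_measureReal_eq_and hpath]
        simp only [hF, and_true]

theorem measureReal_forall_level_le_and_eq [IsFiniteMeasure P]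
    (hX : IsMarkovJumpProcess P Λ π X) (ℓ : E → ℕ) (ht : Monotone t) {c : ℝ≥0}
    (htc : ∀ k < m, t k ≤ c) (j : E) :
    P.real {ω | (∀ k < m, ℓ (X (t k) ω) ≤ k) ∧ X c ω = j} = survivalRow Λ ℓ π t m c j := by
  induction m generalizing c j with
  | zero =>
    have hmarkov (i : E) : P.real {ω | X 0 ω = i ∧ X c ω = j} = π i * transition Λ c i j := by
      simpa [hX.initial] using hX.markov 0 (fun _ => 0) monotone_const (fun _ => i) c j
    have hsum := sum_measureReal_eq_and (P := P) (F := .univ) (fun i _ => hX.measurable 0 i)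
      fun ω => X c ω = j
    simp only [hmarkov, Finset.mem_univ, true_and] at hsum
    simpa [survivalRow, Matrix.vecMul, dotProduct] using hsum.symm
  | succ m ih =>
    have hmc := htc m m.lt_succ_self
    have hmarkov (i : E) :
        P.real {ω | X (t m) ω = i ∧ (∀ k < m + 1, ℓ (X (t k) ω) ≤ k) ∧ X c ω = j} =
          (survivalRow Λ ℓ π t m (t m) ᵥ* levelProj ℓ m) i * transition Λ (c - t m) i j := by
      have hstep :=
        hX.measureReal_forall_mem_and_eq_and_eq ht m (fun k => {i | ℓ i ≤ k}) (c - t m) i j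
      simp only [Set.mem_ofPred_eq, ih (fun _ hk => ht hk.le), add_tsub_cancel_of_le hmc,
        NNReal.coe_sub hmc] at hstep
      have hset : {ω | X (t m) ω = i ∧ (∀ k < m + 1, ℓ (X (t k) ω) ≤ k) ∧ X c ω = j} =
          {ω | ℓ i ≤ m ∧ ((∀ k < m, ℓ (X (t k) ω) ≤ k) ∧ X (t m) ω = i) ∧ X c ω = j} := by
        ext ω
        simp only [Nat.forall_lt_succ_right, Set.mem_ofPred_eq]
        grind
      rw [vecMul_levelProj_apply, hset]
      split_ifs with hi <;> simp [hi, hstep]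
    have hsum := sum_measureReal_eq_and (P := P) (F := .univ) (fun i _ => hX.measurable (t m) i)
      fun ω => (∀ k < m + 1, ℓ (X (t k) ω) ≤ k) ∧ X c ω = j
    simp only [hmarkov, Finset.mem_univ, true_and] at hsum
    exact hsum.symm

theorem measureReal_forall_level_le [IsFiniteMeasure P] (hX : IsMarkovJumpProcess P Λ π X)
    (ℓ : E → ℕ) (ht : Monotone t) (m : ℕ) :
    P.real {ω | ∀ k < m + 1, ℓ (X (t k) ω) ≤ k} =
      survivalRow Λ ℓ π t m (t m) ⬝ᵥ (levelProj ℓ m *ᵥ 1) := by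
  have hsum := sum_measureReal_eq_and (P := P) (F := {i | ℓ i ≤ m})
    (fun i _ => hX.measurable (t m) i) fun ω => ∀ k < m, ℓ (X (t k) ω) ≤ k
  simp only [and_comm (a := X (t m) _ = _),
    hX.measureReal_forall_level_le_and_eq ℓ ht fun _ hk => ht hk.le,
    Finset.sum_filter, Finset.mem_filter, Finset.mem_univ, true_and] at hsum
  simp only [Nat.forall_lt_succ_right, and_comm (b := ℓ _ ≤ m), ← hsum, dotProduct,
    levelProj_mulVec_apply, Pi.one_apply, mul_ite, mul_one, mul_zero]

theorem ae_level_le [IsFiniteMeasure P] (hX : IsMarkovJumpProcess P Λ π X)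
    (h : IsSequentialGenerator Λ ℓ) {s t : ℝ≥0} (hst : s ≤ t) :
    ∀ᵐ ω ∂P, ℓ (X s ω) ≤ ℓ (X t ω) := by
  have hnull (i j : E) (hlt : ℓ j < ℓ i) : ∀ᵐ ω ∂P, ¬ (X s ω = i ∧ X t ω = j) := by
    have h0 := hX.markov 0 (fun _ => s) (fun _ _ _ => le_rfl) (fun _ => i) (t - s) j
    rw [transition_apply_eq_zero h.blockTriangular _ hlt, mul_zero, measureReal_eq_zero_iff] at h0
    filter_upwards [measure_eq_zero_iff_ae_notMem.1 h0] with ω hω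
    simpa [add_tsub_cancel_of_le hst] using hω
  filter_upwards [ae_all_iff.2 fun i => ae_all_iff.2 fun j => ae_all_iff.2 (hnull i j)] with ω hω
  by_contra! hlt
  exact hω _ _ hlt ⟨rfl, rfl⟩

theorem ae_monotone_level [IsFiniteMeasure P] (hX : IsMarkovJumpProcess P Λ π X)
    (h : IsSequentialGenerator Λ ℓ) : ∀ᵐ ω ∂P, Monotone fun t => ℓ (X t ω) := by
  obtain ⟨Q, hQ, hdense⟩ := TopologicalSpace.exists_countable_dense ℝ≥0
  have hQle : ∀ᵐ ω ∂P, ∀ p ∈ Q, ∀ q ∈ Q, p ≤ q → ℓ (X p ω) ≤ ℓ (X q ω) :=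
    (ae_ball_iff hQ).2 fun p _ => (ae_ball_iff hQ).2 fun q _ =>
      ae_all_iff.2 fun hpq => hX.ae_level_le h hpq
  filter_upwards [hQle, hX.right_continuous] with ω hω hrc s t hst
  rcases hst.eq_or_lt with rfl | hst
  · exact le_rfl
  obtain ⟨δ, hδ, hs⟩ := hrc s
  obtain ⟨ε, hε, ht⟩ := hrc t
  obtain ⟨p, hpQ, hsp, hp⟩ := hdense.exists_between (lt_min hst (lt_add_of_pos_right s hδ))
  obtain ⟨q, hqQ, htq, hq⟩ := hdense.exists_between (lt_add_of_pos_right t hε)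
  rw [lt_min_iff] at hp
  have hpq := hω p hpQ q hqQ (hp.1.trans htq).le
  rwa [hs p hsp.le hp.2, ht q htq.le hq] at hpq

end IsMarkovJumpProcess

end MarkovJumpProcess

section SojournLaw

variable {E : Type*} [Fintype E] [DecidableEq E] {Ω : Type*} [MeasurableSpace Ω]
  {P : Measure Ω} [IsFiniteMeasure P] {Λ : Matrix E E ℝ} {ℓ : E → ℕ} {m n : ℕ} {π : E → ℝ}
  {X : ℝ≥0 → Ω → E}

namespace IsMarkovJumpProcess

theorem measureReal_eq (hX : IsMarkovJumpProcess P Λ π X) (t : ℝ≥0) (i : E) :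
    P.real {ω | X t ω = i} = (π ᵥ* transition Λ t) i := by
  simpa [survivalRow] using
    hX.measureReal_forall_level_le_and_eq 0 (m := 0) (monotone_const (c := 0)) (by simp) i

theorem tendsto_measureReal_level_le (hX : IsMarkovJumpProcess P Λ π X)
    (h : IsSequentialGenerator Λ ℓ) (htr : ∀ i, ℓ i ≤ m → IsTransient Λ i) :
    Tendsto (fun t : ℝ≥0 => P.real {ω | ℓ (X t ω) ≤ m}) atTop (𝓝 0) := by
  have hsum (t : ℝ≥0) :
      P.real {ω | ℓ (X t ω) ≤ m} = ∑ i with ℓ i ≤ m, (π ᵥ* transition Λ t) i := by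
    simpa [hX.measureReal_eq] using (sum_measureReal_eq_and (P := P) (F := {i | ℓ i ≤ m})
      (fun i _ => hX.measurable t i) fun _ => True).symm
  simp only [hsum]
  rw [← Finset.sum_const_zero (s := ({i | ℓ i ≤ m} : Finset E))]
  exact tendsto_finsetSum _ fun i hi => (h.tendsto_vecMul_transition_apply htr π
    (Finset.mem_filter.1 hi).2).comp (NNReal.tendsto_coe_atTop.2 tendsto_id)

theorem ae_level_zero_eq (hX : IsMarkovJumpProcess P Λ π X) (hπ : ∀ i, ℓ i ≠ 0 → π i = 0) :
    ∀ᵐ ω ∂P, ℓ (X 0 ω) = 0 := by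
  have hnull (i : E) (hi : ℓ i ≠ 0) : ∀ᵐ ω ∂P, X 0 ω ≠ i :=
    measure_eq_zero_iff_ae_notMem.1
      ((measureReal_eq_zero_iff (measure_ne_top _ _)).1 ((hX.initial i).trans (hπ i hi)))
  filter_upwards [ae_all_iff.2 fun i => ae_all_iff.2 (hnull i)] with ω hω
  by_contra hne
  exact hω _ hne rfl

theorem ae_exists_lt_level (hX : IsMarkovJumpProcess P Λ π X) (h : IsSequentialGenerator Λ ℓ)
    (htr : ∀ i, ℓ i ≤ m → IsTransient Λ i) : ∀ᵐ ω ∂P, ∃ t, m < ℓ (X t ω) := by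
  suffices hnull : P.real {ω | ∀ t, ℓ (X t ω) ≤ m} = 0 by
    filter_upwards [measure_eq_zero_iff_ae_notMem.1
      ((measureReal_eq_zero_iff (measure_ne_top _ _)).1 hnull)] with ω hω
    simpa using hω
  refine le_antisymm ?_ measureReal_nonneg
  exact ge_of_tendsto' (hX.tendsto_measureReal_level_le h htr) fun t =>
    measureReal_mono fun ω hω => hω t

theorem ae_sojournTime_lt_top (hX : IsMarkovJumpProcess P Λ π X) (h : IsSequentialGenerator Λ ℓ)
    (htr : ∀ i, ℓ i < n → IsTransient Λ i) :
    ∀ᵐ ω ∂P, ∀ k < n, sojournTime (fun t => ℓ (X t ω)) k < ∞ := by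
  cases n with
  | zero => simp
  | succ m =>
    filter_upwards [hX.ae_monotone_level h,
      hX.ae_exists_lt_level h fun i hi => htr i (Nat.lt_succ_of_le hi)] with ω hmono ⟨t, ht⟩ k hk
    calc sojournTime (fun t => ℓ (X t ω)) k
        ≤ ∑ l ∈ Finset.Iic m, sojournTime (fun t => ℓ (X t ω)) l :=
          Finset.single_le_sum (fun _ _ => zero_le)
            (Finset.mem_Iic.2 (Nat.le_of_lt_succ hk))
      _ ≤ t := sum_sojournTime_le hmono ht
      _ < ∞ := ENNReal.coe_lt_top

theorem ae_lt_partialSums_sojournVec_iff (hX : IsMarkovJumpProcess P Λ π X)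
    (h : IsSequentialGenerator Λ ℓ) (htr : ∀ i, ℓ i < n → IsTransient Λ i) :
    ∀ᵐ ω ∂P, ∀ (k : Fin n) (t : ℝ≥0),
      (t : ℝ) < partialSums (sojournVec (fun t => ℓ (X t ω)) n) k ↔ ℓ (X t ω) ≤ k := by
  filter_upwards [hX.ae_monotone_level h, hX.ae_eventually_nhdsGE_eq,
    hX.ae_sojournTime_lt_top h htr] with ω hmono hrc hfin
  exact lt_partialSums_sojournVec_iff hmono (fun t => (hrc t).mono fun s hs => congrArg ℓ hs) hfin

theorem aemeasurable_sojournVec (hX : IsMarkovJumpProcess P Λ π X)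
    (h : IsSequentialGenerator Λ ℓ) (htr : ∀ i, ℓ i < n → IsTransient Λ i) :
    AEMeasurable (fun ω => sojournVec (fun t => ℓ (X t ω)) n) P := by
  rw [← measurableEmbedding_partialSums.aemeasurable_comp_iff]
  refine aemeasurable_pi_lambda _ fun k => NullMeasurable.aemeasurable ?_
  refine @measurable_of_Ioi ℝ (NullMeasurableSpace Ω P) _ _ _ _ _ _ _ _ fun c => ?_
  rcases lt_or_ge c 0 with hc | hc
  · convert (@MeasurableSet.univ (NullMeasurableSpace Ω P) _)
    exact Set.eq_univ_of_forall fun ω =>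
      hc.trans_le (partialSums_nonneg (fun _ => ENNReal.toReal_nonneg) k)
  · lift c to ℝ≥0 using hc
    have hlevel : MeasurableSet {ω | ℓ (X c ω) ≤ k} := by
      simpa using measurableSet_mem_finset (F := {i | ℓ i ≤ k}) fun i _ => hX.measurable c i
    refine hlevel.nullMeasurableSet.congr ?_
    filter_upwards [hX.ae_lt_partialSums_sojournVec_iff h htr] with ω hω
    exact propext (hω k c).symm

theorem map_sojournVec (hX : IsMarkovJumpProcess P Λ π X) (h : IsSequentialGenerator Λ ℓ)
    (htr : ∀ i, ℓ i < m + 1 → IsTransient Λ i) (hπ : ∀ i, ℓ i ≠ 0 → π i = 0) :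
    P.map (fun ω => sojournVec (fun t => ℓ (X t ω)) (m + 1)) = pathMeasure Λ ℓ π (m + 1) := by
  have hmeas := hX.aemeasurable_sojournVec h htr
  have hiff := hX.ae_lt_partialSums_sojournVec_iff h htr
  refine ext_of_forall_lt_partialSums ?_ ?_ fun t ht => ?_
  · have hset := (measurableSet_forall_nonneg (m + 1)).inter
      (measurableSet_forall_lt_partialSums (m + 1) 0)
    refine (ae_map_iff hmeas hset).2 ?_
    filter_upwards [hiff, hX.ae_level_zero_eq hπ] with ω hω h0
    exact ⟨fun k => ENNReal.toReal_nonneg, fun k => (hω k 0).2 (h0.trans_le (Nat.zero_le _))⟩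
  · filter_upwards [ae_pathMeasure_pos Λ ℓ π (m + 1)] with y hy
    exact ⟨fun k => (hy k).le, partialSums_pos hy⟩
  · rw [Measure.map_apply_of_aemeasurable hmeas (measurableSet_forall_lt_partialSums _ t),
      h.pathMeasure_forall_lt_partialSums hX.initial_nonneg
        (fun i hi => htr i (Nat.lt_succ_of_le hi)) ht,
      ← hX.measureReal_forall_level_le ℓ ht, ofReal_measureReal]
    refine measure_congr ?_
    filter_upwards [hiff] with ω hω
    refine propext ?_
    exact (forall_congr' fun k => hω k (t k)).trans Fin.forall_iff

end IsMarkovJumpProcess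

end SojournLaw

section BlockModel

variable {n : ℕ} {S : Fin (n + 1) → Type*}

/-- The index of the block that contains a state; the absorbing state `⋆` has the index `n`. -/
def level : State S → ℕ
  | none => n
  | some x => x.1

theorem mem_block_iff {k : Fin n} {x : State S} : x ∈ block S k ↔ level x = k := by
  rcases x with _ | ⟨l, i⟩
  · simp [level, block, k.isLt.ne']
  · simp only [level, block, Set.mem_ofPred_eq, Option.some.injEq, Fin.val_inj]
    constructor
    · rintro ⟨j, hj⟩
      exact congrArg Sigma.fst hj
    · rintro rfl
      exact ⟨i, rfl⟩

theorem occupation_eq_sojournTime {Ω : Type*} (X : ℝ≥0 → Ω → State S) (k : Fin n) (ω : Ω) :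
    occupation X k ω = sojournTime (fun t => level (X t ω)) k := by
  have hblock : block S k = level ⁻¹' {(k : ℕ)} := Set.ext fun _ => mem_block_iff
  rw [occupation, sojournTime, hblock]
  rfl

variable [∀ k, Fintype (S k)] {α : S 0 → ℝ}
  {A : ∀ k : Fin n, Matrix (S k.castSucc) (S k.castSucc) ℝ}
  {D : ∀ k : Fin n, Matrix (S k.castSucc) (S k.succ) ℝ}

theorem gen_eq_zero {x y : State S} (hne : level y ≠ level x) (hne_succ : level y ≠ level x + 1) :
    gen A D x y = 0 := by
  rcases x with _ | ⟨k, i⟩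
  · rfl
  rcases y with _ | ⟨l, j⟩ <;> simp_all [gen, level, Fin.ext_iff, eq_comm]

theorem gen_blockTriangular : (gen A D).BlockTriangular level :=
  fun _ _ hlt => gen_eq_zero hlt.ne (by omega)

theorem isSequentialGenerator_gen (hgen : IsGenerator (gen A D)) :
    IsSequentialGenerator (gen A D) level where
  toIsGenerator := hgen
  rate_eq_zero _ _ := gen_eq_zero

/-- The row vector on the state space that carries `u` on the block `k`. For `k = n`, which only
labels the columns of the last `D`, the entries of `u` are summed up at `⋆`. -/
def blockRow (k : Fin (n + 1)) (u : S k → ℝ) : State S → ℝ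
  | none => if k = Fin.last n then ∑ i, u i else 0
  | some ⟨l, i⟩ => if h : l.castSucc = k then u (cast (congrArg S h) i) else 0

theorem blockRow_apply_eq_zero {k : Fin (n + 1)} {x : State S} (hx : level x ≠ k) (u : S k → ℝ) :
    blockRow k u x = 0 := by
  rcases x with _ | ⟨l, i⟩ <;> simp_all [blockRow, level, Fin.ext_iff, eq_comm]

@[simp]
theorem blockRow_castSucc_apply (k : Fin n) (u : S k.castSucc → ℝ) (i : S k.castSucc) :
    blockRow k.castSucc u (some ⟨k, i⟩) = u i := by
  simp [blockRow]

theorem init_eq_blockRow (hn : n ≠ 0) (α : S 0 → ℝ) : init α = blockRow 0 α := by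
  ext x
  rcases x with _ | ⟨l, i⟩
  · simp [init, blockRow, Fin.ext_iff, hn.symm]
  · rfl

theorem blockRow_last_dotProduct_one (u : S (Fin.last n) → ℝ) :
    blockRow (Fin.last n) u ⬝ᵥ 1 = u ⬝ᵥ 1 := by
  simp [dotProduct, blockRow, Fintype.sum_option, Fin.castSucc_ne_last]

theorem gen_some (k : Fin n) (i : S k.castSucc) :
    gen A D (some ⟨k, i⟩) = blockRow k.castSucc (A k i) + blockRow k.succ (D k i) := by
  ext y
  rcases y with _ | ⟨l, j⟩
  · simp [gen, blockRow, Fin.castSucc_ne_last]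
  · by_cases hl : l.castSucc = k.castSucc
    · simp [gen, blockRow, hl, k.castSucc_lt_succ.ne]
    · simp [gen, blockRow, hl]

theorem sum_eq_sum_block {k : Fin n} {f : State S → ℝ} (hf : ∀ x, level x ≠ k → f x = 0) :
    ∑ x, f x = ∑ i : S k.castSucc, f (some ⟨k, i⟩) := by
  rw [Fintype.sum_option, hf none k.isLt.ne', zero_add, Fintype.sum_sigma]
  refine Finset.sum_eq_single k (fun l _ hl => ?_) (by simp)
  exact Finset.sum_eq_zero fun i _ => hf _ (Fin.val_ne_of_ne hl)

theorem blockRow_vecMul_apply {ι : Type*} [Fintype ι] {k : Fin (n + 1)} (w : ι → ℝ)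
    (M : Matrix ι (S k) ℝ) (x : State S) :
    blockRow k (w ᵥ* M) x = ∑ i, w i * blockRow k (M i) x := by
  rcases x with _ | ⟨l, j⟩
  · by_cases hk : k = Fin.last n
    · simp only [blockRow, hk, if_true, Matrix.vecMul, dotProduct, Finset.mul_sum]
      exact Finset.sum_comm
    · simp [blockRow, hk]
  · by_cases hl : l.castSucc = k
    · simp [blockRow, hl, Matrix.vecMul, dotProduct]
    · simp [blockRow, hl]

theorem exitRate_gen_some (k : Fin n) (i : S k.castSucc) :
    exitRate (gen A D) level k (some ⟨k, i⟩) = blockRow k.succ (D k i) := by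
  ext y
  by_cases hy : level y = k + 1
  · have hcast : blockRow k.castSucc (A k i) y = 0 :=
      blockRow_apply_eq_zero (hy.trans_ne (Nat.succ_ne_self k)) _
    have hsome : level (some ⟨k, i⟩ : State S) = k := rfl
    simp [exitRate, hsome, hy, gen_some, hcast]
  · simp [exitRate, hy, blockRow_apply_eq_zero (k := k.succ) hy]

theorem vecMul_exitRate_gen (v : State S → ℝ) (k : Fin n) :
    v ᵥ* exitRate (gen A D) level k =
      blockRow k.succ ((fun i => v (some ⟨k, i⟩)) ᵥ* D k) := by
  ext y
  calc (v ᵥ* exitRate (gen A D) level k) y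
      = ∑ i : S k.castSucc, v (some ⟨k, i⟩) * exitRate (gen A D) level k (some ⟨k, i⟩) y :=
        sum_eq_sum_block fun x hx => by simp [exitRate, hx]
    _ = blockRow k.succ ((fun i => v (some ⟨k, i⟩)) ᵥ* D k) y := by
        simp only [exitRate_gen_some, blockRow_vecMul_apply]

theorem vecMul_gen_some {v : State S → ℝ} {k : Fin n} (hv : ∀ x, level x < k → v x = 0)
    (j : S k.castSucc) :
    (v ᵥ* gen A D) (some ⟨k, j⟩) = ((fun i => v (some ⟨k, i⟩)) ᵥ* A k) j := by
  have hzero (x : State S) (hx : level x ≠ k) : v x * gen A D x (some ⟨k, j⟩) = 0 := by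
    rcases hx.lt_or_gt with hlt | hgt
    · rw [hv x hlt, zero_mul]
    · exact mul_eq_zero_of_right _ (gen_blockTriangular hgt)
  refine (sum_eq_sum_block hzero).trans (Finset.sum_congr rfl fun i _ => ?_)
  simp [gen]

variable [∀ k, DecidableEq (S k)]

theorem blockRow_vecMul_transition_gen (k : Fin n) (u : S k.castSucc → ℝ) (t : ℝ) :
    (fun j => (blockRow k.castSucc u ᵥ* transition (gen A D) t) (some ⟨k, j⟩)) =
      u ᵥ* NormedSpace.exp (t • A k) := by
  let z (t : ℝ) : State S → ℝ := blockRow k.castSucc u ᵥ* transition (gen A D) t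
  have hzero (t : ℝ) (x : State S) (hx : level x < k) : z t x = 0 := by
    refine Finset.sum_eq_zero fun y _ => ?_
    by_cases hy : level y = k
    · exact mul_eq_zero_of_right _
        (transition_apply_eq_zero gen_blockTriangular t (hx.trans_eq hy.symm))
    · rw [blockRow_apply_eq_zero hy, zero_mul]
  have hderiv (t : ℝ) : HasDerivAt (fun t j => z t (some ⟨k, j⟩))
      ((fun j => z t (some ⟨k, j⟩)) ᵥ* A k) t := by
    refine hasDerivAt_pi.2 fun j => ?_
    rw [← vecMul_gen_some (hzero t)]
    exact hasDerivAt_pi.1 (hasDerivAt_vecMul_transition (gen A D) _ t) _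
  have hinit : (fun j => z 0 (some ⟨k, j⟩)) = u := by
    simp [z, transition_zero]
  exact (eq_vecMul_transition_of_hasDerivAt hderiv t).trans (by rw [hinit, transition])

theorem pathRow_gen (hn : n ≠ 0) (α : S 0 → ℝ) (y : Fin n → ℝ)
    (k : Fin (n + 1)) :
    pathRow (gen A D) level (init α) k (fun l => y (l.castLE k.is_le)) =
      blockRow k (rowProd α A D y k) := by
  induction k using Fin.induction with
  | zero => exact init_eq_blockRow hn α
  | succ k ih =>
    calc pathRow (gen A D) level (init α) (k + 1) (fun l => y (l.castLE k.succ.is_le))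
        = (blockRow k.castSucc (rowProd α A D y k.castSucc) ᵥ* transition (gen A D) (y k)) ᵥ*
            exitRate (gen A D) level k :=
          congrArg (fun v => (v ᵥ* transition (gen A D) (y k)) ᵥ* exitRate (gen A D) level k) ih
      _ = blockRow k.succ (rowProd α A D y k.succ) := by
          rw [vecMul_exitRate_gen, blockRow_vecMul_transition_gen]
          rfl

theorem pathRow_gen_dotProduct_one (hn : n ≠ 0) (α : S 0 → ℝ)
    (y : Fin n → ℝ) : pathRow (gen A D) level (init α) n y ⬝ᵥ 1 = jointDensity α A D y := by
  rw [jointDensity, ← blockRow_last_dotProduct_one, ← pathRow_gen hn]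
  rfl

end BlockModel

end MultPH

theorem mainTheorem1 {n : ℕ} (hn : 1 ≤ n) {S : Fin (n + 1) → Type*}
    [∀ k, Fintype (S k)] [∀ k, DecidableEq (S k)]
    (α : S 0 → ℝ)
    (A : ∀ k : Fin n, Matrix (S k.castSucc) (S k.castSucc) ℝ)
    (D : ∀ k : Fin n, Matrix (S k.castSucc) (S k.succ) ℝ)
    (hgen : MultPH.IsGenerator (MultPH.gen A D))
    (htrans : ∀ (k : Fin n) (i : S k.castSucc),
      MultPH.IsTransient (MultPH.gen A D) (some ⟨k, i⟩))
    {Ω : Type*} [MeasurableSpace Ω] (P : Measure Ω) [IsProbabilityMeasure P]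
    (X : ℝ≥0 → Ω → MultPH.State S)
    (hX : MultPH.IsMarkovJumpProcess P (MultPH.gen A D) (MultPH.init α) X)
    (Y : Ω → Fin n → ℝ)
    (hY : ∀ ω k, Y ω k = (MultPH.occupation X k ω).toReal) :
    (∀ᵐ ω ∂P, ∀ k, MultPH.occupation X k ω < ∞) ∧
    (∀ y : Fin n → ℝ, (∀ k, 0 ≤ y k) → 0 ≤ MultPH.jointDensity α A D y) ∧
    AEMeasurable Y P ∧
    P.map Y = (volume : Measure (Fin n → ℝ)).withDensity
      ({y | ∀ k, 0 ≤ y k}.indicator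
        fun y => ENNReal.ofReal (MultPH.jointDensity α A D y)) := by
  obtain ⟨m, rfl⟩ := Nat.exists_eq_succ_of_ne_zero (Nat.one_le_iff_ne_zero.1 hn)
  have h := MultPH.isSequentialGenerator_gen hgen
  have htr : ∀ x, MultPH.level x < m + 1 → MultPH.IsTransient (MultPH.gen A D) x
    | none, hx => absurd hx (lt_irrefl _)
    | some ⟨k, i⟩, _ => htrans k i
  have hπ (x : MultPH.State S) (hx : MultPH.level x ≠ 0) : MultPH.init α x = 0 := by
    rw [MultPH.init_eq_blockRow m.succ_ne_zero, MultPH.blockRow_apply_eq_zero hx]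
  have hdensity := MultPH.pathRow_gen_dotProduct_one (A := A) (D := D) m.succ_ne_zero α
  have hYvec : Y = fun ω => MultPH.sojournVec (fun t => MultPH.level (X t ω)) (m + 1) := by
    ext ω k
    rw [hY, MultPH.occupation_eq_sojournTime, MultPH.sojournVec]
  refine ⟨?_, fun y hy => ?_, ?_, ?_⟩
  · filter_upwards [hX.ae_sojournTime_lt_top h htr] with ω hfin k
    exact MultPH.occupation_eq_sojournTime X k ω ▸ hfin k k.isLt
  · rw [← hdensity]
    exact dotProduct_nonneg_of_nonneg (hgen.pathRow_nonneg hX.initial_nonneg hy) zero_le_one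
  · exact hYvec ▸ hX.aemeasurable_sojournVec h htr
  · simp only [hYvec, hX.map_sojournVec h htr hπ, MultPH.pathMeasure, hdensity]
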